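/- Let $N\ge 1$, let $\Omega\subset\mathbb{R}^N$ be open and bounded, $1<p<\infty$, $s\in(0,1)$, $A>0$. Let $H:\mathbb{R}^N\times\mathbb{R}^N\times\mathbb{R}\to\mathbb{R}$ be a Carathéodory function (measurable in $(x,y)$ for every $\xi$, continuous in $\xi$ for a.e. $(x,y)$), convex in $\xi$, with $$H(x,y,\xi)\ \ge\ A\left(\frac{|\xi|}{|x-y|^s}\right)^p .$$ For $\psi:\mathbb{R}^N\to\mathbb{R}$ write $\mathcal{E}(\psi)=\iint_{\mathbb{R}^N\times\mathbb{R}^N}\frac{H(x,y,\psi(x)-\psi(y))}{|x-y|^N}\,dx\,dy\in[0,\infty]$. Let $u_0\in W^{s,p}(\mathbb{R}^N)$ with $u_0|_\Omega\in L^2(\Omega)$ and $\mathcal{E}(u_0)<\infty$. Let $W^{s,p}_0(\Omega)$ be the space of functions in $W^{s,p}(\mathbb{R}^N)$ that vanish a.e. outside $\Omega$. A function $u$ on $\mathbb{R}^N\times[0,\infty)$ is called a variational solution of $$\partial_t u+\mathrm{P.V.}\int_{\mathbb{R}^N}\frac{D_\xi H(x,y,u(x,t)-u(y,t))}{|x-y|^N}\,dy=0\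 \text{ in }\Omega\times(0,\infty),\qquad u=u_0\ \text{ on }(\mathbb{R}^N\setminus\Omega)\times(0,\infty)\,\cup\,\Omega\times\{0\},$$ if for every $T>0$ one has $u\in L^p(0,T;W^{s,p}(\mathbb{R}^N))\cap C([0,T];L^2(\Omega))$, $u-u_0\in L^p(0,T;W^{s,p}_0(\Omega))$, and $$\int_0^T\mathcal{E}(u(\cdot,t))\,dt\ \le\ \int_0^T\mathcal{E}(v(\cdot,t))\,dt+\int_0^T\!\!\int_\Omega\partial_t v\,(v-u)\,dx\,dt+\tfrac12\|v(\cdot,0)-u_0\|_{L^2(\Omega)}^2-\tfrac12\|v(\cdot,T)-u(\cdot,T)\|_{L^2(\Omega)}^2$$ for every $v\in L^p(0,T;W^{s,p}(\mathbb{R}^N))\cap C([0,T];L^2(\Omega))$ with $v-u_0\in L^p(0,T;W^{s,p}_0(\Omega))$ and weak time derivative $\partial_t v\in L^2(\Omega\times(0,T))$. If, for a.e. $(x,y)$, the function $\xi\mapsto H(x,y,\xi)$ is strictly convex, then there is at most one variational solution: any two variational solutions $u_1,u_2$ with the same datum $u_0$ agree a.e. on $\mathbb{R}^N\times(0,\infty)$,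 and $u_1(\cdot,t)=u_2(\cdot,t)$ a.e. in $\Omega$ for every $t\ge 0$. -/

import Mathlib

open MeasureTheory Set Filter Topology
open scoped ENNReal ContDiff

noncomputable section

namespace NonlocalEvolution

/-- The space `ℝ^N` with its Euclidean norm. -/
abbrev Space (N : ℕ) : Type := EuclideanSpace ℝ (Fin N)

variable {N : ℕ}

/-- The Gagliardo seminorm `(∬ |ψ(x) - ψ(y)|^p / |x - y|^(N + p s) dx dy)^(1/p)` on `ℝ^N`. -/
def gagliardoSeminorm (s p : ℝ) (ψ : Space N → ℝ) : ℝ≥0∞ :=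
  (∫⁻ z : Space N × Space N,
    ENNReal.ofReal (|ψ z.1 - ψ z.2| ^ p / ‖z.1 - z.2‖ ^ ((N : ℝ) + p * s))) ^ (1 / p)

/-- The norm `‖ψ‖_{L^p} + [ψ]_{W^{s,p}}` of `W^{s,p}(ℝ^N)`, with value `∞` if one of the two terms
is infinite. -/
def wspNorm (s p : ℝ) (ψ : Space N → ℝ) : ℝ≥0∞ :=
  eLpNorm ψ (ENNReal.ofReal p) volume + gagliardoSeminorm s p ψ

/-- `ψ ∈ W^{s,p}(ℝ^N)`. -/
def MemWsp (s p : ℝ) (ψ : Space N → ℝ) : Prop :=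
  MemLp ψ (ENNReal.ofReal p) volume ∧ gagliardoSeminorm s p ψ < ⊤

/-- `ψ ∈ W^{s,p}_0(Ω)`: the function belongs to `W^{s,p}(ℝ^N)` and vanishes outside `Ω`
(almost everywhere, as functions are identified up to null sets). -/
def MemWspZero (Ω : Set (Space N)) (s p : ℝ) (ψ : Space N → ℝ) : Prop :=
  MemWsp s p ψ ∧ ∀ᵐ x : Space N, x ∉ Ω → ψ x = 0

/-- `v ∈ L^p(0,T; W^{s,p}(ℝ^N))`, for a function `v` of time and space, written `v t x`. -/
structure MemLpWsp (s p T : ℝ) (v : ℝ → Space N → ℝ) : Prop where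
  aestronglyMeasurable :
    AEStronglyMeasurable (fun z : ℝ × Space N => v z.1 z.2)
      (volume.restrict (Ioo 0 T ×ˢ (univ : Set (Space N))))
  memWsp : ∀ᵐ t ∂(volume.restrict (Ioo 0 T)), MemWsp s p (v t)
  lintegral_lt_top : ∫⁻ t in Ioo 0 T, wspNorm s p (v t) ^ p < ⊤

/-- `v ∈ L^p(0,T; W^{s,p}_0(Ω))`. -/
structure MemLpWspZero (Ω : Set (Space N)) (s p T : ℝ) (v : ℝ → Space N → ℝ) : Prop where
  memLpWsp : MemLpWsp s p T v
  memWspZero : ∀ᵐ t ∂(volume.restrict (Ioo 0 T)), MemWspZero Ω s p (v t)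

/-- `v ∈ C([0,T]; L²(Ω))`; `v` is its own continuous representative in time, so that
`v t` is meaningful as an element of `L²(Ω)` for every `t ∈ [0,T]`. -/
structure MemCL2 (Ω : Set (Space N)) (T : ℝ) (v : ℝ → Space N → ℝ) : Prop where
  memLp : ∀ t ∈ Icc 0 T, MemLp (v t) 2 (volume.restrict Ω)
  tendsto : ∀ t₀ ∈ Icc 0 T,
    Tendsto (fun t => eLpNorm (v t - v t₀) 2 (volume.restrict Ω)) (𝓝[Icc 0 T] t₀) (𝓝 0)

/-- `∂ₜ v = g ∈ L²(Ω × (0,T))` in the sense of distributions on `Ω × (0,T)`. -/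
structure HasWeakTimeDerivL2 (Ω : Set (Space N)) (T : ℝ) (v g : ℝ → Space N → ℝ) : Prop where
  memLp : MemLp (fun z : ℝ × Space N => g z.1 z.2) 2 (volume.restrict (Ioo 0 T ×ˢ Ω))
  integral_eq : ∀ φ : ℝ × Space N → ℝ, ContDiff ℝ ∞ φ → HasCompactSupport φ →
    tsupport φ ⊆ Ioo 0 T ×ˢ Ω →
    ∫ z in Ioo 0 T ×ˢ Ω, v z.1 z.2 * deriv (fun τ => φ (τ, z.2)) z.1
      = - ∫ z in Ioo 0 T ×ˢ Ω, g z.1 z.2 * φ z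

/-- The structure conditions on `H`: it is a Carathéodory function, convex in the last variable,
and `H(x,y,ξ) ≥ A (|ξ| / |x - y|^s)^p`. -/
structure StructureCondition (A s p : ℝ) (H : Space N → Space N → ℝ → ℝ) : Prop where
  measurable : ∀ ξ : ℝ,
    AEStronglyMeasurable (fun z : Space N × Space N => H z.1 z.2 ξ) volume
  continuous : ∀ᵐ z : Space N × Space N, Continuous (H z.1 z.2)
  convex : ∀ᵐ z : Space N × Space N, ConvexOn ℝ univ (H z.1 z.2)
  lower_bound : ∀ᵐ z : Space N × Space N, ∀ ξ : ℝ,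
    A * (|ξ| / ‖z.1 - z.2‖ ^ s) ^ p ≤ H z.1 z.2 ξ

/-- The nonlocal energy `∬ H(x, y, ψ(x) - ψ(y)) / |x - y|^N dx dy ∈ [0,∞]`. Under the structure
conditions the integrand is nonnegative almost everywhere. -/
def energy (H : Space N → Space N → ℝ → ℝ) (ψ : Space N → ℝ) : ℝ≥0∞ :=
  ∫⁻ z : Space N × Space N, ENNReal.ofReal (H z.1 z.2 (ψ z.1 - ψ z.2) / ‖z.1 - z.2‖ ^ N)

/-- The time-integrated energy `∫₀ᵀ ∬ H(x, y, v(x,t) - v(y,t)) / |x - y|^N dx dy dt ∈ [0,∞]`. -/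
def timeEnergy (H : Space N → Space N → ℝ → ℝ) (T : ℝ) (v : ℝ → Space N → ℝ) : ℝ≥0∞ :=
  ∫⁻ t in Ioo 0 T, energy H (v t)

/-- The assumptions on the time-independent Cauchy-Dirichlet datum `u₀`. -/
structure DataCondition (Ω : Set (Space N)) (s p : ℝ) (H : Space N → Space N → ℝ → ℝ)
    (u₀ : Space N → ℝ) : Prop where
  memWsp : MemWsp s p u₀
  memLp : MemLp u₀ 2 (volume.restrict Ω)
  energy_lt_top : energy H u₀ < ⊤

/-- `v` is a comparison function on `(0,T)` with weak time derivative `g ∈ L²(Ω × (0,T))`.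
The condition `v ∈ C([0,T]; L²(Ω))` gives a meaning to `v(·,0)` and `v(·,T)` in `L²(Ω)`. -/
structure IsComparison (Ω : Set (Space N)) (s p : ℝ) (u₀ : Space N → ℝ) (T : ℝ)
    (v g : ℝ → Space N → ℝ) : Prop where
  memLpWsp : MemLpWsp s p T v
  sub_mem : MemLpWspZero Ω s p T (fun t x => v t x - u₀ x)
  memCL2 : MemCL2 Ω T v
  timeDeriv : HasWeakTimeDerivL2 Ω T v g

/-- `u` is a variational solution of the nonlocal evolution equation with Cauchy-Dirichlet datum
`u₀`. The two energies may be infinite, so the inequality is one between extended reals. -/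
structure IsVariationalSolution (Ω : Set (Space N)) (s p : ℝ) (H : Space N → Space N → ℝ → ℝ)
    (u₀ : Space N → ℝ) (u : ℝ → Space N → ℝ) : Prop where
  memLpWsp : ∀ T > 0, MemLpWsp s p T u
  sub_mem : ∀ T > 0, MemLpWspZero Ω s p T (fun t x => u t x - u₀ x)
  memCL2 : ∀ T > 0, MemCL2 Ω T u
  inequality : ∀ T > 0, ∀ v g : ℝ → Space N → ℝ, IsComparison Ω s p u₀ T v g →
    (timeEnergy H T u : EReal) ≤ (timeEnergy H T v : EReal) +
      (((∫ z in Ioo 0 T ×ˢ Ω, g z.1 z.2 * (v z.1 z.2 - u z.1 z.2))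
        + (1 / 2) * (∫ x in Ω, (v 0 x - u₀ x) ^ 2)
        - (1 / 2) * (∫ x in Ω, (v T x - u T x) ^ 2) : ℝ) : EReal)

end NonlocalEvolution

end

open NonlocalEvolution

/-! Fix `T > 0` and test the variational inequalities of both solutions with the same comparison
function `v`, the exponential mollification in time of the midpoint `w = (u₁ + u₂) / 2`, started
from `u₀`: thus `h ∂ₜv = w - v` and `v(0) = u₀`. In the sum of the two inequalities the time
derivative is multiplied by `2v - u₁ - u₂ = 2(v - w)`, so this term equals `-(2/h) ∬ (w - v)²` and
has a favourable sign. The initial terms vanish.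

For the energies, `v(·,t)` is an average of `w(·,s)`, `0 < s < t`, and of `u₀`, with respect to a
probability measure. Jensen's inequality and Tonelli give `∫ E(v) ≤ h E(u₀) + ∫ E(w)`
(`timeEnergy_mollify_le`), and convexity at the midpoint gives `2 ∫ E(w) ≤ ∫ E(u₁) + ∫ E(u₂)`
(`two_mul_timeEnergy_midpoint_le`). The energies of the solutions are finite
(`IsVariationalSolution.timeEnergy_lt_top`), hence cancel, and what is left bounds `‖u₁(T) -
u₂(T)‖²` in `L²(Ω)` by `8 h E(u₀)` (`integral_sub_sq_le`). Let `h → 0`.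

The technical weight lies in `exists_comparison`: the mollification must be an admissible comparison
function. Every membership is reduced either to a bound for the integral of a convex kernel, so that
one Jensen estimate (`IsConvexKernel.lintegral_mollify_le`) serves the energy, the `W^{s,p}` norm
and the `L²` norm, or to the differential equation at a fixed point of space. -/

namespace NonlocalEvolution

/-! ### Exponential averages of a function of one real variable -/

/-- The solution of `h y' = f - y`, `y 0 = a`: the exponentially weighted average of `f` over
`(0,t)` and of `a` over `(-∞,0)`. -/
noncomputable def expAverage (h a : ℝ) (f : ℝ → ℝ) (t : ℝ) : ℝ :=
  Real.exp (-(t / h)) * (a + h⁻¹ * ∫ s in (0 : ℝ)..t, Real.exp (s / h) * f s)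

section ExpAverage

variable {h a : ℝ} {f : ℝ → ℝ}

@[simp] lemma expAverage_zero : expAverage h a f 0 = a := by simp [expAverage]

lemma intervalIntegrable_exp_mul (hf : Integrable f) (r t : ℝ) :
    IntervalIntegrable (fun s => Real.exp (s / h) * f s) volume r t :=
  hf.intervalIntegrable.continuousOn_mul (by fun_prop)

lemma absolutelyContinuousOnInterval_expAverage (hf : Integrable f) (r t : ℝ) :
    AbsolutelyContinuousOnInterval (expAverage h a f) r t := by
  have hF : AbsolutelyContinuousOnInterval
      (fun t => ∫ s in (0 : ℝ)..t, Real.exp (s / h) * f s) r t :=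
    -- The interval is enlarged to contain the base point `0` of the integral.
    ((intervalIntegrable_exp_mul hf _ _).absolutelyContinuousOnInterval_intervalIntegral
      (a := min 0 (min r t)) (b := max 0 (max r t)) (by simp)).mono (by
        rw [uIcc_of_le (a := min 0 (min r t)) (by simp)]
        exact Icc_subset_Icc (by simp) (by simp))
  have hc : AbsolutelyContinuousOnInterval (fun _ : ℝ => a) r t :=
    contDiffOn_const.absolutelyContinuousOnInterval
  have he : AbsolutelyContinuousOnInterval (fun t : ℝ => Real.exp (-(t / h))) r t :=
    ContDiffOn.absolutelyContinuousOnInterval (by fun_prop)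
  exact he.mul (hc.add (hF.const_mul h⁻¹))

/-- Lebesgue differentiation and the product rule, in which the two exponentials cancel. Since `f`
is merely integrable, the equation holds only almost everywhere; absolute continuity is what allows
it to be integrated back. -/
lemma ae_hasDerivAt_expAverage (hf : Integrable f) :
    ∀ᵐ t : ℝ, HasDerivAt (expAverage h a f) (h⁻¹ * (f t - expAverage h a f t)) t := by
  have hl : LocallyIntegrable (fun s => Real.exp (s / h) * f s) volume :=
    hf.locallyIntegrable.continuous_mul (by fun_prop)
  filter_upwards [LocallyIntegrable.ae_hasDerivAt_integral hl] with t ht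
  have h1 := ((ht 0).const_mul h⁻¹).const_add a
  have h2 : HasDerivAt (fun t : ℝ => Real.exp (-(t / h))) (Real.exp (-(t / h)) * (-(1 / h))) t :=
    (((hasDerivAt_id t).div_const h).neg).exp
  refine (h2.mul h1).congr_deriv ?_
  have h3 : Real.exp (-(t / h)) * Real.exp (t / h) = 1 := by rw [← Real.exp_add]; simp
  simp only [expAverage]
  linear_combination (h⁻¹ * f t) * h3

lemma expAverage_sub (hf : Integrable f) (r t : ℝ) :
    expAverage h a f t - expAverage h a f r
      = ∫ s in r..t, h⁻¹ * (f s - expAverage h a f s) := by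
  rw [← (absolutelyContinuousOnInterval_expAverage hf r t).integral_deriv_eq_sub]
  refine intervalIntegral.integral_congr_ae ?_
  filter_upwards [ae_hasDerivAt_expAverage hf] with s hs _ using hs.deriv

lemma continuous_expAverage (hf : Integrable f) : Continuous (expAverage h a f) := by
  refine continuous_iff_continuousAt.2 fun t => ?_
  refine (absolutelyContinuousOnInterval_expAverage hf (t - 1) (t + 1)).continuousOn.continuousAt ?_
  rw [uIcc_of_le (by linarith)]
  exact Icc_mem_nhds (by linarith) (by linarith)

lemma integral_expAverage_mul_deriv (hf : Integrable f) {T : ℝ} {φ : ℝ → ℝ} (hφ : ContDiff ℝ 1 φ)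
    (h0 : φ 0 = 0) (hT : φ T = 0) :
    ∫ t in (0 : ℝ)..T, expAverage h a f t * deriv φ t
      = - ∫ t in (0 : ℝ)..T, h⁻¹ * (f t - expAverage h a f t) * φ t := by
  rw [(absolutelyContinuousOnInterval_expAverage hf 0 T).integral_mul_deriv_eq_deriv_mul
    hφ.contDiffOn.absolutelyContinuousOnInterval, h0, hT]
  simp only [mul_zero, sub_zero, zero_sub, neg_inj]
  refine intervalIntegral.integral_congr_ae ?_
  filter_upwards [ae_hasDerivAt_expAverage hf] with s hs _
  rw [hs.deriv]

lemma hasDerivAt_exp_div (s : ℝ) (hh : h ≠ 0) :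
    HasDerivAt (fun s => Real.exp (s / h)) (h⁻¹ * Real.exp (s / h)) s := by
  have := ((hasDerivAt_id s).div_const h).exp
  refine this.congr_deriv ?_
  simp only [id]
  field_simp

lemma expAverage_sub_expAverage {b : ℝ} {g : ℝ → ℝ} (hf : Integrable f) (hg : Integrable g)
    (t : ℝ) :
    expAverage h a f t - expAverage h b g t = expAverage h (a - b) (fun s => f s - g s) t := by
  simp only [expAverage, mul_sub]
  rw [intervalIntegral.integral_sub (intervalIntegrable_exp_mul hf _ _)
    (intervalIntegrable_exp_mul hg _ _)]
  ring

/-- The weights have total mass one. This is why mollification preserves a time-independent exterior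
datum. -/
lemma expAverage_of_ae_eq (hh : 0 < h) {t : ℝ} (ht : 0 ≤ t)
    (hfa : ∀ᵐ s ∂(volume.restrict (Ioo 0 t)), f s = a) : expAverage h a f t = a := by
  have h1 : ∫ s in (0 : ℝ)..t, Real.exp (s / h) * f s
      = ∫ s in (0 : ℝ)..t, h⁻¹ * Real.exp (s / h) * (h * a) := by
    rw [intervalIntegral.integral_of_le ht, intervalIntegral.integral_of_le ht,
      integral_Ioc_eq_integral_Ioo, integral_Ioc_eq_integral_Ioo]
    refine integral_congr_ae ?_
    filter_upwards [hfa] with s hs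
    rw [hs]
    field_simp
  rw [expAverage, h1, intervalIntegral.integral_mul_const,
    intervalIntegral.integral_eq_sub_of_hasDerivAt (fun s _ => hasDerivAt_exp_div s hh.ne')
      (Continuous.intervalIntegrable (by fun_prop) _ _)]
  have h3 : Real.exp (-(t / h)) * Real.exp (t / h) = 1 := by rw [← Real.exp_add]; simp
  have h4 : h⁻¹ * h = 1 := inv_mul_cancel₀ hh.ne'
  simp only [zero_div, Real.exp_zero]
  linear_combination a * h3 + a * Real.exp (-(t / h)) * (Real.exp (t / h) - 1) * h4

/-- Jensen's inequality for a nonnegative convex function, without integrability of the right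
hand side. -/
lemma ofReal_convex_integral_le {α : Type*} [MeasurableSpace α] {μ : Measure α}
    [IsProbabilityMeasure μ] {K : ℝ → ℝ} (hK : ConvexOn ℝ univ K) (hKc : Continuous K)
    (hK0 : ∀ x, 0 ≤ K x) {g : α → ℝ} (hg : Integrable g μ) :
    ENNReal.ofReal (K (∫ x, g x ∂μ)) ≤ ∫⁻ x, ENNReal.ofReal (K (g x)) ∂μ := by
  by_cases htop : ∫⁻ x, ENNReal.ofReal (K (g x)) ∂μ = ⊤
  · simp [htop]
  have hi : Integrable (K ∘ g) μ :=
    (lintegral_ofReal_ne_top_iff_integrable (hKc.comp_aestronglyMeasurable hg.1)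
      (Eventually.of_forall fun _ => hK0 _)).1 htop
  calc _ ≤ ENNReal.ofReal (∫ x, K (g x) ∂μ) :=
        ENNReal.ofReal_le_ofReal (hK.map_integral_le hKc.continuousOn isClosed_univ (by simp) hg hi)
    _ = _ := ofReal_integral_eq_lintegral_ofReal hi (Eventually.of_forall fun _ => hK0 _)

lemma lintegral_Ioc_exp_weight (hh : 0 < h) {t : ℝ} (ht : 0 ≤ t) :
    ∫⁻ s in Ioc 0 t, ENNReal.ofReal (h⁻¹ * Real.exp ((s - t) / h))
      = ENNReal.ofReal (1 - Real.exp (-(t / h))) := by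
  rw [← ofReal_integral_eq_lintegral_ofReal
    (Continuous.integrableOn_Ioc (by fun_prop))
    (Eventually.of_forall fun _ => by positivity), ← intervalIntegral.integral_of_le ht]
  have hd : ∀ s ∈ uIcc 0 t, HasDerivAt (fun s => Real.exp ((s - t) / h))
      (h⁻¹ * Real.exp ((s - t) / h)) s := fun s _ =>
    (hasDerivAt_exp_div (s - t) hh.ne').comp_sub_const s t
  rw [intervalIntegral.integral_eq_sub_of_hasDerivAt hd
    (Continuous.intervalIntegrable (by fun_prop) _ _)]
  simp [neg_div]

lemma lintegral_Ioi_exp_weight (hh : 0 < h) (s : ℝ) :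
    ∫⁻ t in Ioi s, ENNReal.ofReal (Real.exp ((s - t) / h)) = ENNReal.ofReal h := by
  have he : ∀ t, Real.exp ((s - t) / h) = Real.exp (s / h) * Real.exp (-h⁻¹ * t) := fun t => by
    rw [← Real.exp_add]; congr 1; ring
  have hneg : -h⁻¹ < 0 := by simpa using hh
  have hi : IntegrableOn (fun t => Real.exp ((s - t) / h)) (Ioi s) := by
    simp_rw [he]
    exact (integrableOn_exp_mul_Ioi hneg s).const_mul _
  rw [← ofReal_integral_eq_lintegral_ofReal hi (Eventually.of_forall fun _ => by positivity)]
  simp_rw [he]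
  rw [integral_const_mul, integral_exp_mul_Ioi hneg]
  congr 1
  have h3 : Real.exp (s / h) * Real.exp (-h⁻¹ * s) = 1 := by
    rw [← Real.exp_add, Real.exp_eq_one_iff]; ring
  have : Real.exp (s / h) * (-Real.exp (-h⁻¹ * s) / -h⁻¹)
      = Real.exp (s / h) * Real.exp (-h⁻¹ * s) * h := by
    field_simp
  rw [this, h3, one_mul]

/-- Jensen's inequality for the probability measure `P` consisting of an atom of mass `exp (-t/h)`
at `0` and the exponential density on `(0,t]`, whose mass is the complementary `1 - exp (-t/h)`. -/
lemma ofReal_convex_expAverage_le (hh : 0 < h) {K : ℝ → ℝ} (hK : ConvexOn ℝ univ K)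
    (hKc : Continuous K) (hK0 : ∀ x, 0 ≤ K x) (hfm : Measurable f) (hf : Integrable f) {t : ℝ}
    (ht : 0 ≤ t) :
    ENNReal.ofReal (K (expAverage h a f t)) ≤
      ENNReal.ofReal (Real.exp (-(t / h))) * ENNReal.ofReal (K a) +
      ∫⁻ s in Ioc 0 t, ENNReal.ofReal (h⁻¹ * Real.exp ((s - t) / h)) * ENNReal.ofReal (K (f s)) := by
  classical
  set w : ℝ → ℝ≥0∞ := fun s => ENNReal.ofReal (h⁻¹ * Real.exp ((s - t) / h)) with hw
  have hwm : Measurable w := by fun_prop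
  set P : Measure ℝ := ENNReal.ofReal (Real.exp (-(t / h))) • Measure.dirac 0 +
    (volume.restrict (Ioc 0 t)).withDensity w with hP
  have hPp : IsProbabilityMeasure P := by
    constructor
    simp only [hP, Measure.add_apply, Measure.smul_apply, smul_eq_mul, measure_univ, mul_one,
      withDensity_apply _ MeasurableSet.univ, Measure.restrict_univ]
    rw [hw, lintegral_Ioc_exp_weight hh ht, ← ENNReal.ofReal_add (by positivity)]
    · simp
    · rw [sub_nonneg, Real.exp_le_one_iff]
      have : 0 ≤ t / h := by positivity
      linarith
  -- A single integrand: `a` at the atom, `f` on `(0,t]`. Its values elsewhere are not charged by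
  -- `P`.
  set F : ℝ → ℝ := (Iic (0 : ℝ)).piecewise (fun _ => a) f with hF
  have hF0 : F 0 = a := by simp [hF]
  have hFs : ∀ s ∈ Ioc 0 t, F s = f s := fun s hs => by
    simp only [hF]
    exact piecewise_eq_of_notMem _ _ _ (by simpa using hs.1)
  have hFm : Measurable F := measurable_const.piecewise measurableSet_Iic hfm
  have hwt : ∀ s, (w s).toReal = h⁻¹ * Real.exp ((s - t) / h) := fun s =>
    ENNReal.toReal_ofReal (by positivity)
  have hi1 : Integrable F (ENNReal.ofReal (Real.exp (-(t / h))) • Measure.dirac 0) :=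
    (integrable_dirac (by simp)).smul_measure ENNReal.ofReal_ne_top
  have hi2 : Integrable F ((volume.restrict (Ioc 0 t)).withDensity w) := by
    rw [integrable_withDensity_iff_integrable_smul' hwm (by simp [hw])]
    simp_rw [hwt, smul_eq_mul]
    have : IntegrableOn (fun s => h⁻¹ * Real.exp ((s - t) / h) * f s) (Ioc 0 t) :=
      (intervalIntegrable_iff_integrableOn_Ioc_of_le ht).1
        (hf.intervalIntegrable.continuousOn_mul (by fun_prop))
    exact this.congr ((ae_restrict_iff' measurableSet_Ioc).2 (Eventually.of_forall fun s hs => by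
      simp [hFs s hs]))
  have hint : ∫ s, F s ∂P = expAverage h a f t := by
    rw [hP, integral_add_measure hi1 hi2, integral_smul_measure, integral_dirac, hF0,
      integral_withDensity_eq_integral_toReal_smul hwm (by simp [hw])]
    simp_rw [hwt]
    rw [ENNReal.toReal_ofReal (by positivity), expAverage, mul_add, smul_eq_mul,
      intervalIntegral.integral_of_le ht, ← integral_const_mul, ← integral_const_mul]
    congr 1
    refine setIntegral_congr_fun measurableSet_Ioc fun s hs => ?_
    simp only [hFs s hs, smul_eq_mul]
    have : (s - t) / h = -(t / h) + s / h := by ring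
    rw [this, Real.exp_add]; ring
  have key := ofReal_convex_integral_le hK hKc hK0 (hi1.add_measure hi2)
  rw [← hP, hint] at key
  refine key.trans (le_of_eq ?_)
  rw [hP, lintegral_add_measure, lintegral_smul_measure, lintegral_dirac, hF0,
    lintegral_withDensity_eq_lintegral_mul _ hwm
      (g := fun s => ENNReal.ofReal (K (F s)))
      (ENNReal.measurable_ofReal.comp (hKc.measurable.comp hFm)), smul_eq_mul]
  congr 1
  refine setLIntegral_congr_fun measurableSet_Ioc fun s hs => ?_
  simp [hFs s hs, hw]

/-- After Tonelli, the weight of `K a` integrates over `t > 0` to `h`, while the density at a fixed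
`s` integrates over `t > s` to one. -/
lemma lintegral_convex_expAverage_le (hh : 0 < h) {K : ℝ → ℝ} (hK : ConvexOn ℝ univ K)
    (hKc : Continuous K) (hK0 : ∀ x, 0 ≤ K x) (hfm : Measurable f) (hf : Integrable f) (T : ℝ) :
    ∫⁻ t in Ioo 0 T, ENNReal.ofReal (K (expAverage h a f t)) ≤
      ENNReal.ofReal h * ENNReal.ofReal (K a) + ∫⁻ t in Ioo 0 T, ENNReal.ofReal (K (f t)) := by
  set G : ℝ → ℝ≥0∞ := fun s => ENNReal.ofReal (K (f s)) with hG
  have hGm : Measurable G := ENNReal.measurable_ofReal.comp (hKc.measurable.comp hfm)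
  -- The constraint `s ≤ t` goes into the kernel, so that both variables range over a fixed
  -- interval.
  set k : ℝ → ℝ → ℝ≥0∞ := fun t s =>
    {q : ℝ × ℝ | q.2 ≤ q.1}.indicator
      (fun q => ENNReal.ofReal (h⁻¹ * Real.exp ((q.2 - q.1) / h)) * G q.2) (t, s) with hk
  have hkm : Measurable (Function.uncurry k) :=
    Measurable.indicator (by fun_prop) (measurableSet_le measurable_snd measurable_fst)
  calc
    _ ≤ ∫⁻ t in Ioo 0 T, (ENNReal.ofReal (Real.exp ((0 - t) / h)) * ENNReal.ofReal (K a) +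
          ∫⁻ s in Ioo 0 T, k t s) := by
        refine setLIntegral_mono' measurableSet_Ioo fun t ht => ?_
        refine (ofReal_convex_expAverage_le hh hK hKc hK0 hfm hf ht.1.le).trans ?_
        rw [zero_sub, neg_div]
        refine add_le_add le_rfl ?_
        calc _ = ∫⁻ s in Ioc 0 t, k t s := by
              refine setLIntegral_congr_fun measurableSet_Ioc fun s hs => ?_
              simp [hk, hs.2, hG]
          _ ≤ _ := lintegral_mono_set (Ioc_subset_Ioo_right ht.2)
    _ = (∫⁻ t in Ioo 0 T, ENNReal.ofReal (Real.exp ((0 - t) / h))) * ENNReal.ofReal (K a) +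
          ∫⁻ s in Ioo 0 T, ∫⁻ t in Ioo 0 T, k t s := by
        rw [lintegral_add_left (by fun_prop), lintegral_mul_const _ (by fun_prop),
          lintegral_lintegral_swap hkm.aemeasurable]
    _ ≤ _ := by
        refine add_le_add (mul_le_mul_left ?_ _) (lintegral_mono fun s => ?_)
        · rw [← lintegral_Ioi_exp_weight hh 0]
          exact lintegral_mono_set Ioo_subset_Ioi_self
        · calc _ ≤ ∫⁻ t, k t s := setLIntegral_le_lintegral _ _
            _ = ∫⁻ t in Ici s, ENNReal.ofReal h⁻¹ *
                  ENNReal.ofReal (Real.exp ((s - t) / h)) * G s := by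
              rw [← lintegral_indicator measurableSet_Ici]
              refine lintegral_congr fun t => ?_
              by_cases hst : s ≤ t
              · simp [hk, hst, ENNReal.ofReal_mul (inv_nonneg.2 hh.le)]
              · simp [hk, hst]
            _ = G s := by
              rw [lintegral_mul_const _ (by fun_prop), lintegral_const_mul _ (by fun_prop),
                setLIntegral_congr Ioi_ae_eq_Ici.symm, lintegral_Ioi_exp_weight hh,
                ← ENNReal.ofReal_mul (inv_nonneg.2 hh.le), inv_mul_cancel₀ hh.ne']
              simp
            _ ≤ _ := le_rfl

end ExpAverage

end NonlocalEvolution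

/-! ### Convex kernels and mollification in time -/

namespace NonlocalEvolution

section Kernel

variable {Z : Type*} [MeasurableSpace Z]

/-- The exponentially weighted average in time of a function of time and space. -/
noncomputable def mollify (h : ℝ) (f₀ : Z → ℝ) (f : ℝ → Z → ℝ) (t : ℝ) (z : Z) : ℝ :=
  expAverage h (f₀ z) (fun s => f s z) t

lemma measurable_mollify {h : ℝ} {f₀ : Z → ℝ} {f : ℝ → Z → ℝ} (hf₀ : Measurable f₀)
    (hf : Measurable (Function.uncurry f)) : Measurable (Function.uncurry (mollify h f₀ f)) := by
  have hs : ∀ S : Set (ℝ × ℝ), MeasurableSet S → Measurable (fun q : ℝ × Z =>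
      ∫ s, S.indicator (fun _ => (1 : ℝ)) (q.1, s) * (Real.exp (s / h) * f s q.2)) := by
    intro S hS
    refine StronglyMeasurable.measurable (StronglyMeasurable.integral_prod_right' (ν := volume)
      (f := fun y : (ℝ × Z) × ℝ => S.indicator (fun _ => (1 : ℝ)) (y.1.1, y.2) *
        (Real.exp (y.2 / h) * f y.2 y.1.2)) (Measurable.stronglyMeasurable ?_))
    have h1 : Measurable fun y : (ℝ × Z) × ℝ => f y.2 y.1.2 :=
      hf.comp (measurable_snd.prodMk measurable_fst.snd)
    have h2 : Measurable fun y : (ℝ × Z) × ℝ => S.indicator (fun _ => (1 : ℝ)) (y.1.1, y.2) :=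
      (measurable_const.indicator hS).comp (measurable_fst.fst.prodMk measurable_snd)
    fun_prop
  -- The moving endpoint is encoded by indicators, which makes these integrals over the whole line
  -- depending on a parameter. The second one accounts for negative times.
  have key : Function.uncurry (mollify h f₀ f) = fun q : ℝ × Z =>
      Real.exp (-(q.1 / h)) * (f₀ q.2 + h⁻¹ *
        ((∫ s, {r : ℝ × ℝ | 0 < r.2 ∧ r.2 ≤ r.1}.indicator (fun _ => (1 : ℝ)) (q.1, s) *
            (Real.exp (s / h) * f s q.2)) -
          ∫ s, {r : ℝ × ℝ | r.1 < r.2 ∧ r.2 ≤ 0}.indicator (fun _ => (1 : ℝ)) (q.1, s) *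
            (Real.exp (s / h) * f s q.2))) := by
    funext q
    simp only [Function.uncurry_def, mollify, expAverage, intervalIntegral]
    rw [← integral_indicator measurableSet_Ioc, ← integral_indicator measurableSet_Ioc]
    simp [indicator_apply]
  rw [key]
  have hS1 := hs {r : ℝ × ℝ | 0 < r.2 ∧ r.2 ≤ r.1}
    ((measurableSet_lt measurable_const measurable_snd).inter
      (measurableSet_le measurable_snd measurable_fst))
  have hS2 := hs {r : ℝ × ℝ | r.1 < r.2 ∧ r.2 ≤ 0}
    ((measurableSet_lt measurable_fst measurable_snd).inter
      (measurableSet_le measurable_snd measurable_const))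
  have h0 : Measurable fun q : ℝ × Z => f₀ q.2 := hf₀.comp measurable_snd
  have h1 : Measurable fun q : ℝ × Z => Real.exp (-(q.1 / h)) := by fun_prop
  exact h1.mul (h0.add ((hS1.sub hS2).const_mul h⁻¹))

/-- A nonnegative integrand, jointly measurable and convex in its last variable. -/
structure IsConvexKernel (K : Z → ℝ → ℝ) : Prop where
  measurable_left : ∀ ξ, Measurable fun z => K z ξ
  continuous : ∀ z, Continuous (K z)
  convex : ∀ z, ConvexOn ℝ univ (K z)
  nonneg : ∀ z ξ, 0 ≤ K z ξ

namespace IsConvexKernel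

variable {K : Z → ℝ → ℝ}

/-- A Carathéodory function is jointly measurable. -/
lemma measurable_comp (hK : IsConvexKernel K) {α : Type*} [MeasurableSpace α] {c : α → Z}
    {f : α → ℝ} (hc : Measurable c) (hf : Measurable f) :
    Measurable fun q => ENNReal.ofReal (K (c q) (f q)) := by
  have h := measurable_uncurry_of_continuous_of_measurable (u := fun ξ z => K z ξ)
    hK.continuous hK.measurable_left
  exact ENNReal.measurable_ofReal.comp (h.comp (hf.prodMk hc))

lemma measurable_apply (hK : IsConvexKernel K) {f : Z → ℝ} (hf : Measurable f) :
    Measurable fun z => ENNReal.ofReal (K z (f z)) :=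
  hK.measurable_comp measurable_id hf

variable (μ : Measure Z)

lemma measurable_lintegral [SFinite μ] (hK : IsConvexKernel K) {f : ℝ → Z → ℝ}
    (hf : Measurable (Function.uncurry f)) :
    Measurable fun t => ∫⁻ z, ENNReal.ofReal (K z (f t z)) ∂μ :=
  Measurable.lintegral_prod_right (f := fun t z => ENNReal.ofReal (K z (f t z)))
    (hK.measurable_comp measurable_snd hf)

lemma two_mul_lintegral_midpoint_le (hK : IsConvexKernel K) {f g : Z → ℝ} (hf : Measurable f)
    (hg : Measurable g) :
    2 * ∫⁻ z, ENNReal.ofReal (K z ((f z + g z) / 2)) ∂μ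
      ≤ ∫⁻ z, ENNReal.ofReal (K z (f z)) ∂μ + ∫⁻ z, ENNReal.ofReal (K z (g z)) ∂μ := by
  rw [← lintegral_add_left (hK.measurable_apply hf),
    ← lintegral_const_mul _ (hK.measurable_apply (f := fun z => (f z + g z) / 2) ((hf.add hg).div_const 2))]
  refine lintegral_mono fun z => ?_
  have h := (hK.convex z).2 (mem_univ (f z)) (mem_univ (g z))
    (show (0 : ℝ) ≤ 1 / 2 by norm_num) (show (0 : ℝ) ≤ 1 / 2 by norm_num) (by norm_num)
  simp only [smul_eq_mul] at h
  have e : (1 / 2 : ℝ) * f z + 1 / 2 * g z = (f z + g z) / 2 := by ring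
  rw [e] at h
  rw [← ENNReal.ofReal_add (hK.nonneg _ _) (hK.nonneg _ _)]
  have : (2 : ℝ≥0∞) = ENNReal.ofReal 2 := by simp
  rw [this, ← ENNReal.ofReal_mul (by norm_num)]
  exact ENNReal.ofReal_le_ofReal (by linarith)

lemma two_mul_lintegral_lintegral_midpoint_le [SFinite μ] (hK : IsConvexKernel K)
    {f g : ℝ → Z → ℝ} (hf : Measurable (Function.uncurry f)) (hg : Measurable (Function.uncurry g))
    (ν : Measure ℝ) :
    2 * ∫⁻ t, ∫⁻ z, ENNReal.ofReal (K z ((f t z + g t z) / 2)) ∂μ ∂ν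
      ≤ ∫⁻ t, ∫⁻ z, ENNReal.ofReal (K z (f t z)) ∂μ ∂ν
        + ∫⁻ t, ∫⁻ z, ENNReal.ofReal (K z (g t z)) ∂μ ∂ν := by
  rw [← lintegral_add_left (hK.measurable_lintegral μ hf),
    ← lintegral_const_mul _ (hK.measurable_lintegral μ (f := fun t z => (f t z + g t z) / 2)
      ((hf.add hg).div_const 2))]
  exact lintegral_mono fun t => hK.two_mul_lintegral_midpoint_le μ (hf.of_uncurry_left)
    (hg.of_uncurry_left)

/-- Tonelli moves the time integral inside; for fixed `z` it is the one-dimensional estimate. -/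
lemma lintegral_mollify_le [SFinite μ] (hK : IsConvexKernel K) {h : ℝ} (hh : 0 < h)
    {f₀ : Z → ℝ} {f : ℝ → Z → ℝ} (hf₀ : Measurable f₀) (hf : Measurable (Function.uncurry f))
    (hfi : ∀ z, Integrable fun s => f s z) (T : ℝ) :
    ∫⁻ t in Ioo 0 T, ∫⁻ z, ENNReal.ofReal (K z (mollify h f₀ f t z)) ∂μ
      ≤ ENNReal.ofReal h * ∫⁻ z, ENNReal.ofReal (K z (f₀ z)) ∂μ
        + ∫⁻ t in Ioo 0 T, ∫⁻ z, ENNReal.ofReal (K z (f t z)) ∂μ := by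
  rw [lintegral_lintegral_swap (hK.measurable_comp measurable_snd
      (measurable_mollify hf₀ hf)).aemeasurable,
    lintegral_lintegral_swap (f := fun t z => ENNReal.ofReal (K z (f t z)))
      (hK.measurable_comp measurable_snd hf).aemeasurable,
    ← lintegral_const_mul _ (hK.measurable_apply hf₀),
    ← lintegral_add_left ((hK.measurable_apply hf₀).const_mul _)]
  exact lintegral_mono fun z => lintegral_convex_expAverage_le hh (hK.convex z) (hK.continuous z)
    (hK.nonneg z) hf.of_uncurry_right (hfi z) T

end IsConvexKernel

end Kernel

end NonlocalEvolution

/-! ### The energy and the `W^{s,p}` norm as integrals of convex kernels -/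

namespace NonlocalEvolution

lemma convexOn_abs_rpow {p : ℝ} (hp : 1 ≤ p) : ConvexOn ℝ univ fun ξ : ℝ => |ξ| ^ p := by
  refine ⟨convex_univ, fun x _ y _ a b ha hb hab => ?_⟩
  have h1 : |a • x + b • y| ≤ a • |x| + b • |y| := by
    simpa [abs_mul, abs_of_nonneg ha, abs_of_nonneg hb] using abs_add_le (a * x) (b * y)
  exact (Real.rpow_le_rpow (abs_nonneg _) h1 (by linarith)).trans
    ((convexOn_rpow hp).2 (abs_nonneg x) (abs_nonneg y) ha hb hab)

lemma isConvexKernel_abs_rpow_div {Z : Type*} [MeasurableSpace Z] {p : ℝ} (hp : 1 ≤ p) {w : Z → ℝ}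
    (hw : Measurable w) (hw0 : ∀ z, 0 ≤ w z) :
    IsConvexKernel fun (z : Z) (ξ : ℝ) => |ξ| ^ p / w z where
  measurable_left ξ := hw.const_div _
  continuous z := (continuous_abs.rpow_const fun _ => Or.inr (by linarith)).div_const _
  convex z := by
    have := (convexOn_abs_rpow hp).smul (inv_nonneg.2 (hw0 z))
    refine this.congr fun ξ _ => ?_
    simp [div_eq_inv_mul]
  nonneg z ξ := div_nonneg (Real.rpow_nonneg (abs_nonneg _) _) (hw0 z)

lemma isConvexKernel_abs_rpow {Z : Type*} [MeasurableSpace Z] {p : ℝ} (hp : 1 ≤ p) :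
    IsConvexKernel fun (_ : Z) (ξ : ℝ) => |ξ| ^ p := by
  simpa using isConvexKernel_abs_rpow_div (Z := Z) hp (w := fun _ => 1) measurable_const (by simp)

variable {N : ℕ}

lemma isConvexKernel_gagliardo {p : ℝ} (hp : 1 ≤ p) (r : ℝ) :
    IsConvexKernel fun (z : Space N × Space N) (ξ : ℝ) => |ξ| ^ p / ‖z.1 - z.2‖ ^ r :=
  isConvexKernel_abs_rpow_div hp (by fun_prop) fun _ => by positivity

/-- After modification on a null set, the density of the energy is a convex kernel. -/
lemma StructureCondition.exists_kernel {A s p : ℝ} {H : Space N → Space N → ℝ → ℝ}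
    (hH : StructureCondition A s p H) (hA : 0 < A) :
    ∃ K : Space N × Space N → ℝ → ℝ, IsConvexKernel K ∧
      ∀ ψ : Space N → ℝ, energy H ψ = ∫⁻ z, ENNReal.ofReal (K z (ψ z.1 - ψ z.2)) := by
  classical
  -- The null set on which `H · · ξ` differs from a measurable function depends on `ξ`. Rational `ξ`
  -- need only one null set, and continuity in `ξ` recovers the rest.
  have hm : ∀ᵐ z : Space N × Space N, ∀ q : ℚ,
      H z.1 z.2 q = (hH.measurable q).mk _ z := ae_all_iff.2 fun q => (hH.measurable q).ae_eq_mk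
  obtain ⟨S, hS, hSm, hSp⟩ :=
    (hH.continuous.and (hH.convex.and (hH.lower_bound.and hm))).exists_measurable_mem
  refine ⟨fun z ξ => S.indicator (fun z => H z.1 z.2 ξ / ‖z.1 - z.2‖ ^ N) z, ?_, ?_⟩
  · refine ⟨fun ξ => ?_, fun z => ?_, fun z => ?_, fun z ξ => ?_⟩
    · obtain ⟨q, hq⟩ := (show ∃ q : ℕ → ℚ, Tendsto (fun n => (q n : ℝ)) atTop (𝓝 ξ) from by
        obtain ⟨u, hu, hlim⟩ := mem_closure_iff_seq_limit.1 (Rat.denseRange_cast (𝕜 := ℝ) ξ)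
        choose q hq using hu
        exact ⟨q, by simpa only [hq] using hlim⟩)
      refine measurable_of_tendsto_metrizable (f := fun n z =>
        S.indicator (fun z => (hH.measurable (q n)).mk _ z / ‖z.1 - z.2‖ ^ N) z) (fun n => ?_) ?_
      · exact Measurable.indicator ((hH.measurable (q n)).stronglyMeasurable_mk.measurable.div
          (by fun_prop)) hSm
      · refine tendsto_pi_nhds.2 fun z => ?_
        by_cases hz : z ∈ S
        · simp only [indicator_of_mem hz]
          refine Tendsto.div_const ?_ _
          simp_rw [← (hSp z hz).2.2.2]
          exact ((hSp z hz).1.tendsto ξ).comp hq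
        · simp [hz]
    · by_cases hz : z ∈ S
      · simpa only [indicator_of_mem hz] using (hSp z hz).1.div_const _
      · simpa [hz] using continuous_const
    · by_cases hz : z ∈ S
      · simp only [indicator_of_mem hz]
        refine ((hSp z hz).2.1.smul (c := (‖z.1 - z.2‖ ^ N)⁻¹) (by positivity)).congr fun ξ _ => ?_
        simp [div_eq_inv_mul]
      · simpa [hz] using convexOn_const 0 convex_univ
    · by_cases hz : z ∈ S
      · simp only [indicator_of_mem hz]
        have h1 := (hSp z hz).2.2.1 ξ
        have h2 : 0 ≤ A * (|ξ| / ‖z.1 - z.2‖ ^ s) ^ p := by positivity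
        exact div_nonneg (h2.trans h1) (by positivity)
      · simp [hz]
  · intro ψ
    refine lintegral_congr_ae ?_
    filter_upwards [hS] with z hz
    simp only [indicator_of_mem hz]

lemma gagliardoSeminorm_rpow {s p : ℝ} (hp : 0 < p) (ψ : Space N → ℝ) :
    gagliardoSeminorm s p ψ ^ p = ∫⁻ z : Space N × Space N,
      ENNReal.ofReal (|ψ z.1 - ψ z.2| ^ p / ‖z.1 - z.2‖ ^ ((N : ℝ) + p * s)) := by
  rw [gagliardoSeminorm, ← ENNReal.rpow_mul, one_div_mul_cancel hp.ne', ENNReal.rpow_one]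

lemma eLpNorm_rpow_eq {α : Type*} [MeasurableSpace α] {μ : Measure α} {p : ℝ} (hp : 0 < p)
    (f : α → ℝ) :
    eLpNorm f (ENNReal.ofReal p) μ ^ p = ∫⁻ x, ENNReal.ofReal (|f x| ^ p) ∂μ := by
  rw [eLpNorm_eq_lintegral_rpow_enorm_toReal (by simpa) (by simp), ENNReal.toReal_ofReal hp.le,
    ← ENNReal.rpow_mul, one_div_mul_cancel hp.ne', ENNReal.rpow_one]
  refine lintegral_congr fun x => ?_
  rw [← ENNReal.ofReal_rpow_of_nonneg (abs_nonneg _) hp.le, Real.enorm_eq_ofReal_abs]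

lemma ae_fst_snd {P : Space N → Prop} (h : ∀ᵐ x, P x) :
    ∀ᵐ z : Space N × Space N, P z.1 ∧ P z.2 := by
  have h1 : ∀ᵐ z : Space N × Space N, P z.1 := Measure.quasiMeasurePreserving_fst.ae h
  have h2 : ∀ᵐ z : Space N × Space N, P z.2 := Measure.quasiMeasurePreserving_snd.ae h
  exact h1.and h2

lemma gagliardoSeminorm_congr {s p : ℝ} {ψ χ : Space N → ℝ} (h : ψ =ᵐ[volume] χ) :
    gagliardoSeminorm s p ψ = gagliardoSeminorm s p χ := by
  unfold gagliardoSeminorm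
  congr 1
  refine lintegral_congr_ae ?_
  filter_upwards [ae_fst_snd h] with z hz
  rw [hz.1, hz.2]

lemma wspNorm_congr {s p : ℝ} {ψ χ : Space N → ℝ} (h : ψ =ᵐ[volume] χ) :
    wspNorm s p ψ = wspNorm s p χ := by
  rw [wspNorm, wspNorm, eLpNorm_congr_ae h, gagliardoSeminorm_congr h]

lemma MemWsp.congr {s p : ℝ} {ψ χ : Space N → ℝ} (hψ : MemWsp s p ψ) (h : ψ =ᵐ[volume] χ) :
    MemWsp s p χ :=
  ⟨hψ.1.ae_eq h, gagliardoSeminorm_congr (s := s) (p := p) h ▸ hψ.2⟩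

lemma energy_congr {H : Space N → Space N → ℝ → ℝ} {ψ χ : Space N → ℝ} (h : ψ =ᵐ[volume] χ) :
    energy H ψ = energy H χ := by
  refine lintegral_congr_ae ?_
  filter_upwards [ae_fst_snd h] with z hz
  rw [hz.1, hz.2]

lemma restrict_Ioo_prod (T : ℝ) (S : Set (Space N)) :
    (volume : Measure (ℝ × Space N)).restrict (Ioo 0 T ×ˢ S)
      = (volume.restrict (Ioo 0 T)).prod (volume.restrict S) := by
  rw [Measure.prod_restrict, ← Measure.volume_eq_prod]

lemma ae_ae_of_ae_restrict_prod {T : ℝ} {S : Set (Space N)} {P : ℝ → Space N → Prop}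
    (h : ∀ᵐ z ∂((volume : Measure (ℝ × Space N)).restrict (Ioo 0 T ×ˢ S)), P z.1 z.2) :
    ∀ᵐ t ∂(volume.restrict (Ioo 0 T)), ∀ᵐ x ∂(volume.restrict S), P t x := by
  rw [restrict_Ioo_prod] at h
  exact Measure.ae_ae_of_ae_prod h

lemma MemLpWsp.congr {s p T : ℝ} {v w : ℝ → Space N → ℝ} (hv : MemLpWsp s p T v)
    (h : ∀ᵐ z ∂((volume : Measure (ℝ × Space N)).restrict (Ioo 0 T ×ˢ univ)),
      v z.1 z.2 = w z.1 z.2) : MemLpWsp s p T w := by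
  have h' := ae_ae_of_ae_restrict_prod (P := fun t x => v t x = w t x) h
  rw [Measure.restrict_univ] at h'
  refine ⟨hv.aestronglyMeasurable.congr h, ?_, ?_⟩
  · filter_upwards [hv.memWsp, h'] with t h1 h2 using h1.congr h2
  · refine lt_of_le_of_lt (le_of_eq (lintegral_congr_ae ?_)) hv.lintegral_lt_top
    filter_upwards [h'] with t h2
    rw [wspNorm_congr h2]

/-- The two integrals which control the norm of `L^p(0,T; W^{s,p})` are finite. -/
def FiniteWspIntegrals (s p T : ℝ) (v : ℝ → Space N → ℝ) : Prop :=
  ∫⁻ t in Ioo 0 T, ∫⁻ x, ENNReal.ofReal (|v t x| ^ p) < ⊤ ∧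
  ∫⁻ t in Ioo 0 T, ∫⁻ z : Space N × Space N,
    ENNReal.ofReal (|v t z.1 - v t z.2| ^ p / ‖z.1 - z.2‖ ^ ((N : ℝ) + p * s)) < ⊤

lemma MemLpWsp.finiteWspIntegrals {s p T : ℝ} (hp : 0 < p) {v : ℝ → Space N → ℝ}
    (hv : MemLpWsp s p T v) : FiniteWspIntegrals s p T v := by
  constructor
  · refine lt_of_le_of_lt (lintegral_mono fun t => ?_) hv.lintegral_lt_top
    rw [← eLpNorm_rpow_eq hp]
    exact ENNReal.rpow_le_rpow le_self_add hp.le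
  · refine lt_of_le_of_lt (lintegral_mono fun t => ?_) hv.lintegral_lt_top
    rw [← gagliardoSeminorm_rpow hp]
    exact ENNReal.rpow_le_rpow le_add_self hp.le

lemma measurable_difference {v : ℝ → Space N → ℝ} (hv : Measurable (Function.uncurry v)) :
    Measurable (Function.uncurry fun t (z : Space N × Space N) => v t z.1 - v t z.2) := by
  have h1 : Measurable fun q : ℝ × (Space N × Space N) => v q.1 q.2.1 :=
    hv.comp (measurable_fst.prodMk measurable_snd.fst)
  have h2 : Measurable fun q : ℝ × (Space N × Space N) => v q.1 q.2.2 :=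
    hv.comp (measurable_fst.prodMk measurable_snd.snd)
  exact h1.sub h2

/-- Up to the factor `2 ^ p`, the power `wspNorm ^ p` is the sum of two integrals of convex kernels,
to which the midpoint and mollification estimates apply directly. -/
lemma FiniteWspIntegrals.memLpWsp {s p T : ℝ} (hp : 1 ≤ p) {v : ℝ → Space N → ℝ}
    (hvm : Measurable (Function.uncurry v)) (hv : FiniteWspIntegrals s p T v) :
    MemLpWsp s p T v := by
  have hp0 : 0 < p := by linarith
  have m1 := (isConvexKernel_abs_rpow (Z := Space N) hp).measurable_lintegral volume hvm
  have m2 := (isConvexKernel_gagliardo (N := N) hp (N + p * s)).measurable_lintegral volume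
    (measurable_difference hvm)
  refine ⟨hvm.aestronglyMeasurable, ?_, ?_⟩
  · filter_upwards [ae_lt_top m1 hv.1.ne, ae_lt_top m2 hv.2.ne] with t h1 h2
    rw [← eLpNorm_rpow_eq hp0, ENNReal.rpow_lt_top_iff_of_pos hp0] at h1
    rw [← gagliardoSeminorm_rpow hp0, ENNReal.rpow_lt_top_iff_of_pos hp0] at h2
    exact ⟨⟨hvm.of_uncurry_left.aestronglyMeasurable, h1⟩, h2⟩
  · calc _ ≤ ∫⁻ t in Ioo 0 T, 2 ^ p * ((∫⁻ x, ENNReal.ofReal (|v t x| ^ p)) +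
          ∫⁻ z : Space N × Space N,
            ENNReal.ofReal (|v t z.1 - v t z.2| ^ p / ‖z.1 - z.2‖ ^ ((N : ℝ) + p * s))) := by
          refine lintegral_mono fun t => ?_
          rw [← eLpNorm_rpow_eq hp0, ← gagliardoSeminorm_rpow hp0]
          exact ENNReal.add_rpow_le_two_rpow_mul_rpow_add_rpow _ _ hp0.le
      _ < ⊤ := by
          rw [lintegral_const_mul' _ _ (ENNReal.rpow_ne_top_of_nonneg hp0.le (by simp)), lintegral_add_left m1]
          exact ENNReal.mul_lt_top (ENNReal.rpow_lt_top_of_nonneg hp0.le (by simp))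
            (ENNReal.add_lt_top.2 hv)

lemma FiniteWspIntegrals.midpoint {s p T : ℝ} (hp : 1 ≤ p) {v w : ℝ → Space N → ℝ}
    (hvm : Measurable (Function.uncurry v)) (hwm : Measurable (Function.uncurry w))
    (hv : FiniteWspIntegrals s p T v) (hw : FiniteWspIntegrals s p T w) :
    FiniteWspIntegrals s p T fun t x => (v t x + w t x) / 2 := by
  constructor
  · have h := (isConvexKernel_abs_rpow (Z := Space N) hp).two_mul_lintegral_lintegral_midpoint_le
      volume hvm hwm (volume.restrict (Ioo 0 T))
    exact (ENNReal.lt_top_of_mul_ne_top_right (h.trans_lt (ENNReal.add_lt_top.2 ⟨hv.1, hw.1⟩)).ne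
      two_ne_zero)
  · have h := (isConvexKernel_gagliardo (N := N) hp
      (N + p * s)).two_mul_lintegral_lintegral_midpoint_le volume (measurable_difference hvm)
      (measurable_difference hwm) (volume.restrict (Ioo 0 T))
    have h' := (ENNReal.lt_top_of_mul_ne_top_right
      (h.trans_lt (ENNReal.add_lt_top.2 ⟨hv.2, hw.2⟩)).ne two_ne_zero)
    simpa only [← add_sub_add_comm, sub_div] using h'

lemma MemLpWsp.exists_measurable {s p T : ℝ} {v : ℝ → Space N → ℝ} (hv : MemLpWsp s p T v) :
    ∃ w : ℝ → Space N → ℝ, Measurable (Function.uncurry w) ∧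
      ∀ᵐ z ∂((volume : Measure (ℝ × Space N)).restrict (Ioo 0 T ×ˢ univ)),
        v z.1 z.2 = w z.1 z.2 :=
  ⟨fun t x => hv.aestronglyMeasurable.mk _ (t, x),
    hv.aestronglyMeasurable.stronglyMeasurable_mk.measurable, hv.aestronglyMeasurable.ae_eq_mk⟩

lemma MemLpWsp.midpoint {s p T : ℝ} (hp : 1 ≤ p) {v w : ℝ → Space N → ℝ}
    (hv : MemLpWsp s p T v) (hw : MemLpWsp s p T w) :
    MemLpWsp s p T fun t x => (v t x + w t x) / 2 := by
  obtain ⟨v', hvm, hvv⟩ := hv.exists_measurable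
  obtain ⟨w', hwm, hww⟩ := hw.exists_measurable
  have hp0 : 0 < p := by linarith
  have h := ((hv.congr hvv).finiteWspIntegrals hp0).midpoint hp hvm hwm
    ((hw.congr hww).finiteWspIntegrals hp0)
  refine (h.memLpWsp hp ((hvm.add hwm).div_const 2)).congr ?_
  filter_upwards [hvv, hww] with z h1 h2
  rw [h1, h2]

/-- Averaging in time is linear, hence commutes with differences in space. This turns a nonlocal
energy into a kernel integral over pairs of points. -/
lemma mollify_difference {h : ℝ} {f₀ : Space N → ℝ} {f : ℝ → Space N → ℝ}
    (hfi : ∀ x, Integrable fun s => f s x) (t : ℝ) (z : Space N × Space N) :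
    mollify h f₀ f t z.1 - mollify h f₀ f t z.2
      = mollify h (fun z : Space N × Space N => f₀ z.1 - f₀ z.2)
          (fun t z => f t z.1 - f t z.2) t z :=
  expAverage_sub_expAverage (hfi z.1) (hfi z.2) t

/-- An energy given by a convex kernel increases by at most `h` times its value at the initial
datum under mollification in time. -/
lemma lintegral_mollify_difference_le {K : Space N × Space N → ℝ → ℝ} (hK : IsConvexKernel K)
    {h : ℝ} (hh : 0 < h) {f₀ : Space N → ℝ} {f : ℝ → Space N → ℝ} (hf₀ : Measurable f₀)
    (hf : Measurable (Function.uncurry f)) (hfi : ∀ x, Integrable fun s => f s x) (T : ℝ) :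
    ∫⁻ t in Ioo 0 T, ∫⁻ z : Space N × Space N,
        ENNReal.ofReal (K z (mollify h f₀ f t z.1 - mollify h f₀ f t z.2))
      ≤ ENNReal.ofReal h * (∫⁻ z, ENNReal.ofReal (K z (f₀ z.1 - f₀ z.2)))
        + ∫⁻ t in Ioo 0 T, ∫⁻ z : Space N × Space N, ENNReal.ofReal (K z (f t z.1 - f t z.2)) := by
  simp_rw [mollify_difference hfi]
  exact hK.lintegral_mollify_le volume hh (by fun_prop) (measurable_difference hf)
    (fun z => (hfi z.1).sub (hfi z.2)) T

lemma MemLpWsp.mollify {s p T h : ℝ} (hp : 1 ≤ p) (hh : 0 < h) {f₀ : Space N → ℝ}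
    {f : ℝ → Space N → ℝ} (hf₀m : Measurable f₀) (hf₀ : MemWsp s p f₀)
    (hfm : Measurable (Function.uncurry f)) (hfi : ∀ x, Integrable fun s => f s x)
    (hf : MemLpWsp s p T f) : MemLpWsp s p T (mollify h f₀ f) := by
  have hp0 : 0 < p := by linarith
  refine FiniteWspIntegrals.memLpWsp hp (measurable_mollify hf₀m hfm) ⟨?_, ?_⟩
  · refine ((isConvexKernel_abs_rpow hp).lintegral_mollify_le volume hh hf₀m hfm hfi T).trans_lt
      (ENNReal.add_lt_top.2 ⟨ENNReal.mul_lt_top ENNReal.ofReal_lt_top ?_,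
        (hf.finiteWspIntegrals hp0).1⟩)
    rw [← eLpNorm_rpow_eq hp0]
    exact ENNReal.rpow_lt_top_of_nonneg hp0.le hf₀.1.2.ne
  · refine (lintegral_mollify_difference_le (isConvexKernel_gagliardo hp _) hh hf₀m hfm hfi
      T).trans_lt (ENNReal.add_lt_top.2 ⟨ENNReal.mul_lt_top ENNReal.ofReal_lt_top ?_,
        (hf.finiteWspIntegrals hp0).2⟩)
    rw [← gagliardoSeminorm_rpow hp0]
    exact ENNReal.rpow_lt_top_of_nonneg hp0.le hf₀.2.ne

end NonlocalEvolution

/-! ### Square integrability, continuity in time and the weak time derivative -/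

namespace NonlocalEvolution

lemma eLpNorm_two_rpow_two {α : Type*} [MeasurableSpace α] {μ : Measure α} (f : α → ℝ) :
    eLpNorm f 2 μ ^ (2 : ℝ) = ∫⁻ x, ENNReal.ofReal (|f x| ^ (2 : ℝ)) ∂μ := by
  have h := eLpNorm_rpow_eq (μ := μ) (p := 2) two_pos f
  simpa using h

lemma memLp_two_iff {α : Type*} [MeasurableSpace α] {μ : Measure α} {f : α → ℝ}
    (hf : AEStronglyMeasurable f μ) :
    MemLp f 2 μ ↔ ∫⁻ x, ENNReal.ofReal (|f x| ^ (2 : ℝ)) ∂μ < ⊤ := by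
  rw [← eLpNorm_two_rpow_two, ENNReal.rpow_lt_top_iff_of_pos two_pos]
  exact ⟨fun h => h.2, fun h => ⟨hf, h⟩⟩

/-- Cauchy-Schwarz for the integral of the derivative over the interval between `r` and `t`. -/
lemma ofReal_abs_expAverage_sub_rpow_le {h a : ℝ} {f : ℝ → ℝ} (hfm : Measurable f)
    (hf : Integrable f) {T r t : ℝ} (hr : r ∈ Icc 0 T) (ht : t ∈ Icc 0 T) :
    ENNReal.ofReal (|expAverage h a f t - expAverage h a f r| ^ (2 : ℝ)) ≤
      ENNReal.ofReal |t - r| *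
        ∫⁻ s in Ioo 0 T, ENNReal.ofReal (|h⁻¹ * (f s - expAverage h a f s)| ^ (2 : ℝ)) := by
  set g : ℝ → ℝ := fun s => h⁻¹ * (f s - expAverage h a f s) with hg
  have hgm : Measurable g := (hfm.sub (continuous_expAverage hf).measurable).const_mul _
  rw [expAverage_sub hf, ← ENNReal.ofReal_rpow_of_nonneg (abs_nonneg _) zero_le_two,
    ← Real.enorm_eq_ofReal_abs, ← eLpNorm_two_rpow_two]
  have h1 : ‖∫ s in r..t, g s‖ₑ ≤ eLpNorm g 1 (volume.restrict (uIoc r t)) := by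
    rw [eLpNorm_one_eq_lintegral_enorm, ← ofReal_norm,
      intervalIntegral.norm_intervalIntegral_eq, ofReal_norm]
    exact enorm_integral_le_lintegral_enorm _
  have h2 := eLpNorm_le_eLpNorm_mul_rpow_measure_univ (μ := volume.restrict (uIoc r t))
    (p := 1) (q := 2) one_le_two hgm.aestronglyMeasurable
  have hsub : uIoc r t ⊆ Ioc 0 T := by
    intro s hs
    rw [mem_uIoc] at hs
    rcases hs with hs | hs
    · exact ⟨hr.1.trans_lt hs.1, hs.2.trans ht.2⟩
    · exact ⟨ht.1.trans_lt hs.1, hs.2.trans hr.2⟩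
  have h3 : eLpNorm g 2 (volume.restrict (uIoc r t)) ≤ eLpNorm g 2 (volume.restrict (Ioo 0 T)) := by
    rw [restrict_Ioo_eq_restrict_Ioc]
    exact eLpNorm_mono_measure _ (Measure.restrict_mono hsub le_rfl)
  have h4 : (volume.restrict (uIoc r t)) univ = ENNReal.ofReal |t - r| := by
    rw [Measure.restrict_apply_univ, uIoc, Real.volume_Ioc, max_sub_min_eq_abs]
  rw [h4] at h2
  calc ‖∫ s in r..t, g s‖ₑ ^ (2 : ℝ)
      ≤ (eLpNorm g 2 (volume.restrict (Ioo 0 T)) *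
          ENNReal.ofReal |t - r| ^ (1 / 2 : ℝ)) ^ (2 : ℝ) := by
        refine ENNReal.rpow_le_rpow (h1.trans (h2.trans ?_)) zero_le_two
        refine mul_le_mul' h3 (le_of_eq ?_)
        norm_num
    _ = _ := by
        rw [ENNReal.mul_rpow_of_nonneg _ _ zero_le_two, ← ENNReal.rpow_mul]
        norm_num [mul_comm, hg]

variable {N : ℕ} {Ω : Set (Space N)} {T : ℝ}

lemma memLp_two_prod_iff {v : ℝ → Space N → ℝ}
    (hv : AEStronglyMeasurable (fun z : ℝ × Space N => v z.1 z.2)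
      (volume.restrict (Ioo 0 T ×ˢ Ω))) :
    MemLp (fun z : ℝ × Space N => v z.1 z.2) 2 (volume.restrict (Ioo 0 T ×ˢ Ω)) ↔
      ∫⁻ t in Ioo 0 T, ∫⁻ x in Ω, ENNReal.ofReal (|v t x| ^ (2 : ℝ)) < ⊤ := by
  rw [memLp_two_iff hv]
  rw [restrict_Ioo_prod] at hv ⊢
  rw [lintegral_prod _ (by
    exact (ENNReal.measurable_ofReal.comp
      ((measurable_norm (α := ℝ)).pow_const (2 : ℝ))).comp_aemeasurable hv.aemeasurable)]

/-- Continuity bounds the norm near each time, and `[0,T]` is compact. -/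
lemma MemCL2.exists_eLpNorm_le {v : ℝ → Space N → ℝ} (hv : MemCL2 Ω T v) :
    ∃ C : ℝ≥0∞, C < ⊤ ∧ ∀ t ∈ Icc 0 T, eLpNorm (v t) 2 (volume.restrict Ω) ≤ C := by
  refine isCompact_Icc.induction_on (p := fun S => ∃ C : ℝ≥0∞, C < ⊤ ∧
    ∀ t ∈ S ∩ Icc 0 T, eLpNorm (v t) 2 (volume.restrict Ω) ≤ C) ⟨0, by simp⟩ ?_ ?_ ?_ |>.imp
      fun C hC => ⟨hC.1, fun t ht => hC.2 t ⟨ht, ht⟩⟩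
  · rintro S S' hS ⟨C, hC, h⟩
    exact ⟨C, hC, fun t ht => h t ⟨hS ht.1, ht.2⟩⟩
  · rintro S S' ⟨C, hC, h⟩ ⟨C', hC', h'⟩
    refine ⟨max C C', max_lt hC hC', fun t ht => ?_⟩
    rcases ht.1 with h1 | h1
    · exact (h t ⟨h1, ht.2⟩).trans (le_max_left _ _)
    · exact (h' t ⟨h1, ht.2⟩).trans (le_max_right _ _)
  · intro t₀ ht₀
    have h1 := (hv.tendsto t₀ ht₀).eventually_lt_const zero_lt_one
    refine ⟨{t | eLpNorm (v t - v t₀) 2 (volume.restrict Ω) < 1}, h1,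
      1 + eLpNorm (v t₀) 2 (volume.restrict Ω),
      ENNReal.add_lt_top.2 ⟨ENNReal.one_lt_top, (hv.memLp t₀ ht₀).2⟩, fun t ht => ?_⟩
    calc eLpNorm (v t) 2 (volume.restrict Ω)
        = eLpNorm ((v t - v t₀) + v t₀) 2 (volume.restrict Ω) := by simp
      _ ≤ _ := (eLpNorm_add_le ((hv.memLp t ht.2).1.sub (hv.memLp t₀ ht₀).1)
          (hv.memLp t₀ ht₀).1 one_le_two).trans (add_le_add (le_of_lt ht.1) le_rfl)

lemma MemCL2.memLp_prod {v : ℝ → Space N → ℝ} (hv : MemCL2 Ω T v)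
    (hvm : AEStronglyMeasurable (fun z : ℝ × Space N => v z.1 z.2)
      (volume.restrict (Ioo 0 T ×ˢ Ω))) :
    MemLp (fun z : ℝ × Space N => v z.1 z.2) 2 (volume.restrict (Ioo 0 T ×ˢ Ω)) := by
  obtain ⟨C, hC, h⟩ := hv.exists_eLpNorm_le
  rw [memLp_two_prod_iff hvm]
  calc _ ≤ ∫⁻ _ in Ioo 0 T, C ^ (2 : ℝ) := by
        refine setLIntegral_mono' measurableSet_Ioo fun t ht => ?_
        rw [← eLpNorm_two_rpow_two]
        exact ENNReal.rpow_le_rpow (h t ⟨ht.1.le, ht.2.le⟩) zero_le_two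
    _ < ⊤ := by
        rw [setLIntegral_const]
        exact ENNReal.mul_lt_top (ENNReal.rpow_lt_top_of_nonneg zero_le_two hC.ne) (by simp)

section Mollify

variable {h : ℝ} {f₀ : Space N → ℝ} {f : ℝ → Space N → ℝ}

lemma memLp_mollify_prod (hh : 0 < h) (hf₀m : Measurable f₀)
    (hfm : Measurable (Function.uncurry f)) (hfi : ∀ x, Integrable fun s => f s x)
    (hf₀ : MemLp f₀ 2 (volume.restrict Ω))
    (hf : MemLp (fun z : ℝ × Space N => f z.1 z.2) 2 (volume.restrict (Ioo 0 T ×ˢ Ω))) :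
    MemLp (fun z : ℝ × Space N => mollify h f₀ f z.1 z.2) 2
      (volume.restrict (Ioo 0 T ×ˢ Ω)) := by
  rw [memLp_two_prod_iff (measurable_mollify hf₀m hfm).aestronglyMeasurable]
  rw [memLp_two_prod_iff hfm.aestronglyMeasurable] at hf
  rw [memLp_two_iff hf₀m.aestronglyMeasurable] at hf₀
  exact ((isConvexKernel_abs_rpow one_le_two).lintegral_mollify_le _ hh hf₀m hfm hfi T).trans_lt
    (ENNReal.add_lt_top.2 ⟨ENNReal.mul_lt_top ENNReal.ofReal_lt_top hf₀, hf⟩)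

lemma memLp_mollify_deriv_prod (hh : 0 < h) (hf₀m : Measurable f₀)
    (hfm : Measurable (Function.uncurry f)) (hfi : ∀ x, Integrable fun s => f s x)
    (hf₀ : MemLp f₀ 2 (volume.restrict Ω))
    (hf : MemLp (fun z : ℝ × Space N => f z.1 z.2) 2 (volume.restrict (Ioo 0 T ×ˢ Ω))) :
    MemLp (fun z : ℝ × Space N => h⁻¹ * (f z.1 z.2 - mollify h f₀ f z.1 z.2)) 2
      (volume.restrict (Ioo 0 T ×ˢ Ω)) :=
  (hf.sub (memLp_mollify_prod hh hf₀m hfm hfi hf₀ hf)).const_mul _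

/-- Integrating the pointwise Cauchy-Schwarz bound over `Ω` gives `‖v(t) - v(r)‖² ≤ |t - r| ‖∂ₜv‖²`,
with the last norm in `L²(Ω × (0,T))`. Membership in `L²(Ω)` at time `t` follows by comparison with
`v(0) = f₀`. -/
lemma memCL2_mollify (hh : 0 < h) (hf₀m : Measurable f₀)
    (hfm : Measurable (Function.uncurry f)) (hfi : ∀ x, Integrable fun s => f s x)
    (hf₀ : MemLp f₀ 2 (volume.restrict Ω))
    (hf : MemLp (fun z : ℝ × Space N => f z.1 z.2) 2 (volume.restrict (Ioo 0 T ×ˢ Ω))) :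
    MemCL2 Ω T (mollify h f₀ f) := by
  have hvm := measurable_mollify (h := h) hf₀m hfm
  have hvt : ∀ t, Measurable (mollify h f₀ f t) := fun t => hvm.of_uncurry_left
  have hgm : Measurable (Function.uncurry fun t x => h⁻¹ * (f t x - mollify h f₀ f t x)) :=
    (hfm.sub hvm).const_mul _
  set G : ℝ≥0∞ := ∫⁻ x in Ω, ∫⁻ s in Ioo 0 T,
    ENNReal.ofReal (|h⁻¹ * (f s x - mollify h f₀ f s x)| ^ (2 : ℝ)) with hG
  have hGt : G < ⊤ := by
    have := (memLp_two_prod_iff (v := fun t x => h⁻¹ * (f t x - mollify h f₀ f t x))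
      hgm.aestronglyMeasurable).1 (memLp_mollify_deriv_prod hh hf₀m hfm hfi hf₀ hf)
    rwa [lintegral_lintegral_swap ((isConvexKernel_abs_rpow (Z := Space N)
      one_le_two).measurable_comp measurable_snd hgm).aemeasurable] at this
  have key : ∀ t ∈ Icc 0 T, ∀ r ∈ Icc 0 T,
      eLpNorm (mollify h f₀ f t - mollify h f₀ f r) 2 (volume.restrict Ω)
        ≤ (ENNReal.ofReal |t - r| * G) ^ (1 / 2 : ℝ) := by
    intro t ht r hr
    rw [one_div, ENNReal.le_rpow_inv_iff two_pos, eLpNorm_two_rpow_two, hG,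
      ← lintegral_const_mul' _ _ ENNReal.ofReal_ne_top]
    exact lintegral_mono fun x => ofReal_abs_expAverage_sub_rpow_le hfm.of_uncurry_right (hfi x)
      hr ht
  refine ⟨fun t ht => ?_, fun t₀ ht₀ => ?_⟩
  · have h0 : mollify h f₀ f 0 = f₀ := by
      funext x
      exact expAverage_zero
    have h1 : MemLp (mollify h f₀ f t - mollify h f₀ f 0) 2 (volume.restrict Ω) :=
      ⟨((hvt t).sub (hvt 0)).aestronglyMeasurable,
        (key t ht 0 ⟨le_rfl, ht.1.trans ht.2⟩).trans_lt (ENNReal.rpow_lt_top_of_nonneg (by norm_num)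
          (ENNReal.mul_lt_top ENNReal.ofReal_lt_top hGt).ne)⟩
    have h2 := h1.add hf₀
    rwa [h0, sub_add_cancel] at h2
  · have hlim : Tendsto (fun t => (ENNReal.ofReal |t - t₀| * G) ^ (1 / 2 : ℝ)) (𝓝[Icc 0 T] t₀)
        (𝓝 0) := by
      have h1 : Tendsto (fun t => ENNReal.ofReal |t - t₀|) (𝓝[Icc 0 T] t₀) (𝓝 0) := by
        have : Continuous fun t : ℝ => ENNReal.ofReal |t - t₀| :=
          ENNReal.continuous_ofReal.comp (by fun_prop)
        have h2 := this.tendsto t₀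
        simp only [sub_self, abs_zero, ENNReal.ofReal_zero] at h2
        exact h2.mono_left nhdsWithin_le_nhds
      have h2 := (ENNReal.continuous_rpow_const (y := 1 / 2)).tendsto 0 |>.comp
        (by simpa using ENNReal.Tendsto.mul_const h1 (Or.inr hGt.ne))
      simpa [Function.comp_def] using h2
    refine tendsto_of_tendsto_of_tendsto_of_le_of_le' tendsto_const_nhds hlim
      (Eventually.of_forall fun _ => zero_le) ?_
    filter_upwards [self_mem_nhdsWithin] with t ht using key t ht t₀ ht₀

/-- Fubini reduces the identity to integration by parts at fixed `x`. Finite measure of `Ω` turns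
`L²` into `L¹`, which, with bounded test functions, justifies Fubini. -/
lemma hasWeakTimeDerivL2_mollify (hT : 0 < T) (hΩ : volume Ω < ⊤) (hh : 0 < h)
    (hf₀m : Measurable f₀) (hfm : Measurable (Function.uncurry f))
    (hfi : ∀ x, Integrable fun s => f s x) (hf₀ : MemLp f₀ 2 (volume.restrict Ω))
    (hf : MemLp (fun z : ℝ × Space N => f z.1 z.2) 2 (volume.restrict (Ioo 0 T ×ˢ Ω))) :
    HasWeakTimeDerivL2 Ω T (mollify h f₀ f) fun t x => h⁻¹ * (f t x - mollify h f₀ f t x) := by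
  have hv := memLp_mollify_prod hh hf₀m hfm hfi hf₀ hf
  have hg := memLp_mollify_deriv_prod hh hf₀m hfm hfi hf₀ hf
  refine ⟨hg, fun φ hφ hφc hφs => ?_⟩
  have : IsFiniteMeasure ((volume : Measure (Space N)).restrict Ω) := ⟨by simpa using hΩ⟩
  have hφ' : (fun z : ℝ × Space N => deriv (fun τ => φ (τ, z.2)) z.1)
      = fun z => fderiv ℝ φ z (1, 0) := by
    funext z
    have h1 : HasDerivAt (fun τ : ℝ => (τ, z.2)) ((1 : ℝ), (0 : Space N)) z.1 :=
      (hasDerivAt_id z.1).prodMk (hasDerivAt_const z.1 z.2)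
    have h2 : HasFDerivAt φ (fderiv ℝ φ (z.1, z.2)) (z.1, z.2) :=
      (hφ.differentiable (by simp)).differentiableAt.hasFDerivAt
    exact (h2.comp_hasDerivAt z.1 h1).deriv
  have hdc : Continuous fun z => fderiv ℝ φ z (1, 0) :=
    (hφ.continuous_fderiv (by simp)).clm_apply continuous_const
  obtain ⟨C, hC⟩ := (hφc.fderiv_apply ℝ (1, 0)).exists_bound_of_continuous hdc
  obtain ⟨D, hD⟩ := hφc.exists_bound_of_continuous hφ.continuous
  -- The boundary terms at `0` and `T` vanish for every `x`.
  have h0 : ∀ t ∉ Ioo 0 T, ∀ x, φ (t, x) = 0 := fun t ht x => by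
    by_contra hne
    exact ht (hφs (subset_tsupport φ hne)).1
  have hc : ∀ x, ContDiff ℝ 1 fun τ => φ (τ, x) := fun x =>
    (hφ.of_le (by simp)).comp (by fun_prop)
  rw [restrict_Ioo_prod] at hv hg ⊢
  have hvi := hv.integrable one_le_two
  have hgi := hg.integrable one_le_two
  have i1 : Integrable (fun z : ℝ × Space N => mollify h f₀ f z.1 z.2 *
      deriv (fun τ => φ (τ, z.2)) z.1)
      ((volume.restrict (Ioo 0 T)).prod (volume.restrict Ω)) := by
    refine hvi.mul_bdd (c := C) ?_ ?_
    · rw [hφ']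
      exact hdc.aestronglyMeasurable
    · refine Eventually.of_forall fun z => ?_
      rw [congrFun hφ' z]
      exact hC z
  have i2 := hgi.mul_bdd (c := D) hφ.continuous.aestronglyMeasurable (Eventually.of_forall hD)
  rw [integral_prod_symm _ i1, integral_prod_symm _ i2, ← integral_neg]
  refine integral_congr_ae (Eventually.of_forall fun x => ?_)
  have key := integral_expAverage_mul_deriv (h := h) (a := f₀ x) (hfi x) (hc x) (h0 0 (by simp) x)
    (h0 T (by simp) x)
  rwa [intervalIntegral.integral_of_le hT.le, intervalIntegral.integral_of_le hT.le,
    integral_Ioc_eq_integral_Ioo, integral_Ioc_eq_integral_Ioo] at key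

end Mollify

end NonlocalEvolution

/-! ### The mollified comparison function -/

namespace NonlocalEvolution

variable {N : ℕ} {Ω : Set (Space N)} {s p T : ℝ} {H : Space N → Space N → ℝ → ℝ}

lemma timeEnergy_congr {v w : ℝ → Space N → ℝ}
    (h : ∀ᵐ z ∂((volume : Measure (ℝ × Space N)).restrict (Ioo 0 T ×ˢ univ)),
      v z.1 z.2 = w z.1 z.2) : timeEnergy H T v = timeEnergy H T w := by
  have h' := ae_ae_of_ae_restrict_prod (P := fun t x => v t x = w t x) h
  rw [Measure.restrict_univ] at h'
  refine lintegral_congr_ae ?_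
  filter_upwards [h'] with t ht using energy_congr ht

lemma ae_restrict_Ioo_prod_of_ae {S : Set (Space N)} {P : Space N → Prop} (h : ∀ᵐ x, P x) :
    ∀ᵐ z ∂((volume : Measure (ℝ × Space N)).restrict (Ioo 0 T ×ˢ S)), P z.2 :=
  ae_restrict_of_ae (Measure.quasiMeasurePreserving_snd.ae h)

lemma ae_restrict_prod_mono {S : Set (Space N)} {P : ℝ × Space N → Prop}
    (h : ∀ᵐ z ∂((volume : Measure (ℝ × Space N)).restrict (Ioo 0 T ×ˢ univ)), P z) :
    ∀ᵐ z ∂((volume : Measure (ℝ × Space N)).restrict (Ioo 0 T ×ˢ S)), P z :=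
  ae_restrict_of_ae_restrict_of_subset (prod_mono_right (subset_univ S)) h

/-- A jointly measurable representative which is integrable in time for every point of space. -/
lemma MemLpWsp.exists_measurable_integrable {v : ℝ → Space N → ℝ} (hp : 1 ≤ p)
    (hv : MemLpWsp s p T v) :
    ∃ f : ℝ → Space N → ℝ, Measurable (Function.uncurry f) ∧
      (∀ x, Integrable fun t => f t x) ∧
      ∀ᵐ z ∂((volume : Measure (ℝ × Space N)).restrict (Ioo 0 T ×ˢ univ)),
        v z.1 z.2 = f z.1 z.2 := by
  have hp0 : 0 < p := by linarith
  obtain ⟨w, hwm, hvw⟩ := hv.exists_measurable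
  have hw := ((hv.congr hvw).finiteWspIntegrals hp0).1
  -- The points where the time integral makes sense. They have full measure because `L^p(0,T) ⊆
  -- L¹(0,T)`; the representative is set to zero over the other points and outside `(0,T)`.
  set B : Set (Space N) := {x | ∫⁻ t in Ioo 0 T, ‖w t x‖ₑ < ⊤} with hB
  have hBm : MeasurableSet B :=
    measurableSet_lt (Measurable.lintegral_prod_left (f := fun t x => ‖w t x‖ₑ) hwm.enorm)
      measurable_const
  have hBae : ∀ᵐ x, x ∈ B := by
    have hm := (isConvexKernel_abs_rpow (Z := Space N) hp).measurable_comp measurable_snd hwm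
    rw [lintegral_lintegral_swap (f := fun t x => ENNReal.ofReal (|w t x| ^ p))
      hm.aemeasurable] at hw
    filter_upwards [ae_lt_top (Measurable.lintegral_prod_left
      (f := fun t x => ENNReal.ofReal (|w t x| ^ p)) hm) hw.ne] with x hx
    rw [← eLpNorm_rpow_eq hp0, ENNReal.rpow_lt_top_iff_of_pos hp0] at hx
    have : MemLp (fun t => w t x) (ENNReal.ofReal p) (volume.restrict (Ioo 0 T)) :=
      ⟨hwm.of_uncurry_right.aestronglyMeasurable, hx⟩
    exact (this.integrable (by simpa using hp)).2
  refine ⟨fun t x => (Ioo 0 T ×ˢ B).indicator (Function.uncurry w) (t, x),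
    hwm.indicator (measurableSet_Ioo.prod hBm), fun x => ?_, ?_⟩
  · by_cases hx : x ∈ B
    · have : (fun t => (Ioo 0 T ×ˢ B).indicator (Function.uncurry w) (t, x))
          = (Ioo 0 T).indicator fun t => w t x := by
        funext t
        simp [indicator_apply, hx]
      rw [this, integrable_indicator_iff measurableSet_Ioo]
      exact ⟨hwm.of_uncurry_right.aestronglyMeasurable, hx⟩
    · simp [hx]
  · filter_upwards [hvw, ae_restrict_Ioo_prod_of_ae (S := univ) hBae,
      ae_restrict_mem (measurableSet_Ioo.prod MeasurableSet.univ)] with z h1 h2 h3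
    rw [h1, indicator_of_mem (show (z.1, z.2) ∈ Ioo 0 T ×ˢ B from ⟨h3.1, h2⟩)]
    rfl

lemma memWsp_zero (hp : 0 < p) : MemWsp s p (0 : Space N → ℝ) := by
  refine ⟨MemLp.zero', ?_⟩
  simp [gagliardoSeminorm, Real.zero_rpow hp.ne', hp]

lemma DataCondition.memLpWsp_const {u₀ : Space N → ℝ} (hp : 0 < p)
    (hu₀ : DataCondition Ω s p H u₀) : MemLpWsp s p T fun _ => u₀ := by
  refine ⟨?_, Eventually.of_forall fun _ => hu₀.memWsp, ?_⟩
  · exact (hu₀.memWsp.1.1.comp_quasiMeasurePreserving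
      (Measure.quasiMeasurePreserving_snd (μ := (volume : Measure ℝ)))).restrict
  · rw [setLIntegral_const]
    refine ENNReal.mul_lt_top (ENNReal.rpow_lt_top_of_nonneg hp.le ?_) (by simp)
    exact (ENNReal.add_lt_top.2 ⟨hu₀.memWsp.1.2, hu₀.memWsp.2⟩).ne

lemma memLpWspZero_zero (hp : 0 < p) :
    MemLpWspZero Ω s p T fun (_ : ℝ) (_ : Space N) => (0 : ℝ) := by
  have h0 : MemWsp s p fun _ : Space N => (0 : ℝ) := memWsp_zero hp
  refine ⟨⟨aestronglyMeasurable_const, Eventually.of_forall fun _ => h0, ?_⟩,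
    Eventually.of_forall fun _ => ⟨h0, Eventually.of_forall fun _ _ => rfl⟩⟩
  rw [setLIntegral_const]
  refine ENNReal.mul_lt_top (ENNReal.rpow_lt_top_of_nonneg hp.le ?_) (by simp)
  exact (ENNReal.add_lt_top.2 ⟨h0.1.2, h0.2⟩).ne

lemma HasWeakTimeDerivL2.congr {v g g' : ℝ → Space N → ℝ} (h : HasWeakTimeDerivL2 Ω T v g)
    (hg : ∀ᵐ z ∂((volume : Measure (ℝ × Space N)).restrict (Ioo 0 T ×ˢ Ω)),
      g z.1 z.2 = g' z.1 z.2) : HasWeakTimeDerivL2 Ω T v g' := by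
  refine ⟨h.memLp.ae_eq hg, fun φ hφ hφc hφs => ?_⟩
  rw [h.integral_eq φ hφ hφc hφs]
  congr 1
  refine integral_congr_ae ?_
  filter_upwards [hg] with z hz
  rw [hz]

lemma timeEnergy_mollify_le {A : ℝ} (hH : StructureCondition A s p H) (hA : 0 < A) {h : ℝ}
    (hh : 0 < h) {f₀ : Space N → ℝ} {f : ℝ → Space N → ℝ} (hf₀ : Measurable f₀)
    (hf : Measurable (Function.uncurry f)) (hfi : ∀ x, Integrable fun s => f s x) :
    timeEnergy H T (mollify h f₀ f) ≤ ENNReal.ofReal h * energy H f₀ + timeEnergy H T f := by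
  obtain ⟨K, hK, hHK⟩ := hH.exists_kernel hA
  simp only [timeEnergy, hHK]
  exact lintegral_mollify_difference_le hK hh hf₀ hf hfi T

lemma two_mul_timeEnergy_midpoint_le {A : ℝ} (hH : StructureCondition A s p H) (hA : 0 < A)
    {v w : ℝ → Space N → ℝ} (hv : MemLpWsp s p T v) (hw : MemLpWsp s p T w) :
    2 * timeEnergy H T (fun t x => (v t x + w t x) / 2)
      ≤ timeEnergy H T v + timeEnergy H T w := by
  obtain ⟨v', hvm, hvv⟩ := hv.exists_measurable
  obtain ⟨w', hwm, hww⟩ := hw.exists_measurable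
  obtain ⟨K, hK, hHK⟩ := hH.exists_kernel hA
  rw [timeEnergy_congr hvv, timeEnergy_congr hww,
    timeEnergy_congr (w := fun t x => (v' t x + w' t x) / 2)
      (by filter_upwards [hvv, hww] with z h1 h2; rw [h1, h2])]
  have h := hK.two_mul_lintegral_lintegral_midpoint_le volume (measurable_difference hvm)
      (measurable_difference hwm) (volume.restrict (Ioo 0 T))
  simp only [timeEnergy, hHK]
  simpa only [← add_sub_add_comm, sub_div] using h

/-- The exponential mollification in time, started from the datum, is a comparison function, and
its energy is controlled. -/
lemma exists_comparison {A : ℝ} (hH : StructureCondition A s p H) (hA : 0 < A) (hp : 1 < p)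
    (hΩm : MeasurableSet Ω) (hΩ : volume Ω < ⊤) (hT : 0 < T) {u₀ : Space N → ℝ}
    (hu₀ : DataCondition Ω s p H u₀) {w : ℝ → Space N → ℝ} (hw : MemLpWsp s p T w)
    (hw0 : MemLpWspZero Ω s p T fun t x => w t x - u₀ x)
    (hw2 : MemLp (fun z : ℝ × Space N => w z.1 z.2) 2 (volume.restrict (Ioo 0 T ×ˢ Ω)))
    {h : ℝ} (hh : 0 < h) :
    ∃ v : ℝ → Space N → ℝ,
      IsComparison Ω s p u₀ T v (fun t x => h⁻¹ * (w t x - v t x)) ∧ v 0 =ᵐ[volume] u₀ ∧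
      timeEnergy H T v ≤ ENNReal.ofReal h * energy H u₀ + timeEnergy H T w := by
  have hp0 : 0 < p := by linarith
  obtain ⟨f, hfm, hfi, hwf⟩ := hw.exists_measurable_integrable hp.le
  set U : Space N → ℝ := hu₀.memWsp.1.1.mk u₀ with hU
  have hUm : Measurable U := hu₀.memWsp.1.1.stronglyMeasurable_mk.measurable
  have hUe : u₀ =ᵐ[volume] U := hu₀.memWsp.1.1.ae_eq_mk
  have hUL : MemLp U 2 (volume.restrict Ω) := hu₀.memLp.ae_eq (ae_restrict_of_ae hUe)
  have hwfΩ := ae_restrict_prod_mono (S := Ω) hwf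
  have hfL : MemLp (fun z : ℝ × Space N => f z.1 z.2) 2 (volume.restrict (Ioo 0 T ×ˢ Ω)) :=
    hw2.ae_eq hwfΩ
  set v := mollify h U f with hv
  have hv0 : v 0 = U := by
    funext x
    exact expAverage_zero
  have hvW : MemLpWsp s p T v :=
    MemLpWsp.mollify hp.le hh hUm (hu₀.memWsp.congr hUe) hfm hfi (hw.congr hwf)
  have hUprod := ae_restrict_Ioo_prod_of_ae (T := T) (S := univ) hUe
  have hmem := ae_restrict_mem (μ := (volume : Measure (ℝ × Space N)))
    ((measurableSet_Ioo (a := (0 : ℝ)) (b := T)).prod (MeasurableSet.univ (α := Space N)))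
  -- A representative of `w - u₀`, with the constant cut off in time to stay integrable on the line.
  -- On `(0,T)`, `v - U` is the mollification of `f'` started from `0`, and so inherits its
  -- `W^{s,p}` bounds.
  set f' : ℝ → Space N → ℝ := fun t x => f t x - (Ioo 0 T).indicator (fun _ => U x) t with hf'
  have hci : ∀ x, Integrable ((Ioo 0 T).indicator fun _ => U x) := fun x =>
    (integrable_indicator_iff measurableSet_Ioo).2 (by simp)
  have hf'm : Measurable (Function.uncurry f') := by
    refine hfm.sub ?_
    have : (fun q : ℝ × Space N => (Ioo 0 T).indicator (fun _ => U q.2) q.1)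
        = (Ioo 0 T ×ˢ univ).indicator fun q => U q.2 := by
      funext q
      simp [indicator_apply]
    rw [this]
    exact (hUm.comp measurable_snd).indicator (measurableSet_Ioo.prod MeasurableSet.univ)
  have hvU : ∀ t ∈ Ioo 0 T, ∀ x, v t x - U x = mollify h (fun _ => 0) f' t x := by
    intro t ht x
    have h1 : expAverage h (U x) ((Ioo 0 T).indicator fun _ => U x) t = U x := by
      refine expAverage_of_ae_eq hh ht.1.le ((ae_restrict_iff' measurableSet_Ioo).2
        (Eventually.of_forall fun r hr => ?_))
      rw [indicator_of_mem (show r ∈ Ioo 0 T from ⟨hr.1, hr.2.trans ht.2⟩)]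
    have h2 := expAverage_sub_expAverage (h := h) (a := U x) (b := U x) (hfi x) (hci x) t
    rw [h1, sub_self] at h2
    exact h2
  have hsubW : MemLpWsp s p T fun t x => v t x - u₀ x := by
    have h1 : MemLpWsp s p T f' := hw0.memLpWsp.congr (by
      filter_upwards [hwf, hUprod, hmem] with z a1 a2 a3
      simp [hf', a1, a2, indicator_of_mem a3.1])
    refine (h1.mollify (h := h) (f₀ := fun _ => 0) hp.le hh measurable_const (memWsp_zero hp0) hf'm
      (fun x => (hfi x).sub (hci x))).congr ?_
    filter_upwards [hUprod, hmem] with z a2 a3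
    rw [a2, hvU z.1 a3.1]
  have hvan : ∀ᵐ x, ∀ t ∈ Ioo 0 T, x ∉ Ω → v t x - u₀ x = 0 := by
    have h1 : ∀ᵐ t ∂(volume.restrict (Ioo 0 T)), ∀ᵐ x, x ∉ Ω → f t x = U x := by
      have hwf' := ae_ae_of_ae_restrict_prod (P := fun t x => w t x = f t x) hwf
      rw [Measure.restrict_univ] at hwf'
      filter_upwards [hwf', hw0.memWspZero] with t a1 a2
      filter_upwards [a1, a2.2, hUe] with x b1 b2 b3 hx
      rw [← b1, ← b3]
      linarith [b2 hx]
    -- The average is taken at fixed `x`, so the exterior condition is needed for almost every `t`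
    -- at almost every `x`, rather than in the given order.
    rw [Measure.ae_ae_comm (p := fun t x => x ∉ Ω → f t x = U x) (by
      have : {q : ℝ × Space N | q.2 ∉ Ω → f q.1 q.2 = U q.2}
          = {q | q.2 ∈ Ω} ∪ {q | f q.1 q.2 = U q.2} := by
        ext q
        simp only [mem_ofPred_eq, mem_union]
        tauto
      rw [this]
      exact (measurable_snd hΩm).union (measurableSet_eq_fun hfm (hUm.comp measurable_snd)))] at h1
    filter_upwards [h1, hUe] with x a1 a2 t ht hx
    have : v t x = U x := by
      refine expAverage_of_ae_eq hh ht.1.le ?_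
      filter_upwards [ae_restrict_of_ae_restrict_of_subset (Ioo_subset_Ioo_right ht.2.le) a1]
        with r hr using hr hx
    rw [this, a2, sub_self]
  refine ⟨v, ⟨hvW, ⟨hsubW, ?_⟩, memCL2_mollify hh hUm hfm hfi hUL hfL, ?_⟩, ?_, ?_⟩
  · filter_upwards [hsubW.memWsp, ae_restrict_mem measurableSet_Ioo] with t ht htm
    refine ⟨ht, ?_⟩
    filter_upwards [hvan] with x hx using hx t htm
  · refine (hasWeakTimeDerivL2_mollify hT hΩ hh hUm hfm hfi hUL hfL).congr ?_
    filter_upwards [hwfΩ] with z hz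
    rw [hz]
  · rw [hv0]
    exact hUe.symm
  · rw [energy_congr hUe, timeEnergy_congr hwf]
    exact timeEnergy_mollify_le hH hA hh hUm hfm hfi

end NonlocalEvolution

/-! ### Comparison of two solutions -/

namespace NonlocalEvolution

variable {N : ℕ} {Ω : Set (Space N)} {s p A : ℝ} {H : Space N → Space N → ℝ → ℝ}
  {u₀ : Space N → ℝ} {u u₁ u₂ : ℝ → Space N → ℝ}

lemma IsVariationalSolution.memLp_prod (hu : IsVariationalSolution Ω s p H u₀ u) {T : ℝ}
    (hT : 0 < T) :
    MemLp (fun z : ℝ × Space N => u z.1 z.2) 2 (volume.restrict (Ioo 0 T ×ˢ Ω)) :=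
  (hu.memCL2 T hT).memLp_prod ((hu.memLpWsp T hT).aestronglyMeasurable.mono_measure
    (Measure.restrict_mono (prod_mono_right (subset_univ Ω)) le_rfl))

/-- Testing with a mollification of the constant-in-time datum bounds the energy by a finite
quantity; the parameter `1` is arbitrary. Finiteness is what permits subtracting energies later. -/
lemma IsVariationalSolution.timeEnergy_lt_top (hu : IsVariationalSolution Ω s p H u₀ u)
    (hH : StructureCondition A s p H) (hA : 0 < A) (hp : 1 < p) (hΩm : MeasurableSet Ω)
    (hΩ : volume Ω < ⊤) (hu₀ : DataCondition Ω s p H u₀) {T : ℝ} (hT : 0 < T) :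
    timeEnergy H T u < ⊤ := by
  have hp0 : 0 < p := by linarith
  obtain ⟨v, hv, -, hvE⟩ := exists_comparison hH hA hp hΩm hΩ hT hu₀
    (w := fun _ => u₀) (hu₀.memLpWsp_const hp0) (by simpa using memLpWspZero_zero hp0)
    (by
      have : IsFiniteMeasure (volume.restrict (Ioo (0 : ℝ) T)) := ⟨by simp⟩
      rw [restrict_Ioo_prod]
      exact hu₀.memLp.comp_snd _) one_pos
  have hvt : timeEnergy H T v < ⊤ := by
    refine hvE.trans_lt (ENNReal.add_lt_top.2 ⟨ENNReal.mul_lt_top ENNReal.ofReal_lt_top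
      hu₀.energy_lt_top, ?_⟩)
    rw [timeEnergy, setLIntegral_const]
    exact ENNReal.mul_lt_top hu₀.energy_lt_top (by simp)
  have key := hu.inequality T hT v _ hv
  by_contra htop
  rw [not_lt, top_le_iff] at htop
  rw [htop, ← ENNReal.ofReal_toReal hvt.ne, EReal.coe_ennreal_ofReal,
    max_eq_left ENNReal.toReal_nonneg, ← EReal.coe_add, EReal.coe_ennreal_top, top_le_iff] at key
  exact EReal.coe_ne_top _ key

/-- The variational inequality between real numbers, for a comparison function which starts from
the datum. -/
lemma IsVariationalSolution.toReal_inequality (hu : IsVariationalSolution Ω s p H u₀ u)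
    {T : ℝ} (hT : 0 < T) (huE : timeEnergy H T u < ⊤) {v g : ℝ → Space N → ℝ}
    (hv : IsComparison Ω s p u₀ T v g) (hvE : timeEnergy H T v < ⊤) (hv0 : v 0 =ᵐ[volume] u₀) :
    (timeEnergy H T u).toReal ≤ (timeEnergy H T v).toReal +
      (∫ z in Ioo 0 T ×ˢ Ω, g z.1 z.2 * (v z.1 z.2 - u z.1 z.2))
        - 1 / 2 * ∫ x in Ω, (v T x - u T x) ^ 2 := by
  have key := hu.inequality T hT v _ hv
  have h0 : ∫ x in Ω, (v 0 x - u₀ x) ^ 2 = 0 := by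
    refine integral_eq_zero_of_ae ?_
    filter_upwards [ae_restrict_of_ae hv0] with x hx
    simp [hx]
  rw [← ENNReal.ofReal_toReal hvE.ne, ← ENNReal.ofReal_toReal huE.ne, EReal.coe_ennreal_ofReal,
    EReal.coe_ennreal_ofReal, max_eq_left ENNReal.toReal_nonneg,
    max_eq_left ENNReal.toReal_nonneg, ← EReal.coe_add, EReal.coe_le_coe_iff, h0] at key
  linarith

/-- The quantitative estimate: mollification with parameter `h` separates two solutions by at most
a multiple of `h`. -/
lemma integral_sub_sq_le (hH : StructureCondition A s p H) (hA : 0 < A) (hp : 1 < p)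
    (hΩm : MeasurableSet Ω) (hΩ : volume Ω < ⊤) (hu₀ : DataCondition Ω s p H u₀)
    (h₁ : IsVariationalSolution Ω s p H u₀ u₁) (h₂ : IsVariationalSolution Ω s p H u₀ u₂)
    {T : ℝ} (hT : 0 < T) {h : ℝ} (hh : 0 < h) :
    ∫ x in Ω, (u₁ T x - u₂ T x) ^ 2 ≤ 8 * (h * (energy H u₀).toReal) := by
  set w : ℝ → Space N → ℝ := fun t x => (u₁ t x + u₂ t x) / 2 with hw
  have hE₁ := h₁.timeEnergy_lt_top hH hA hp hΩm hΩ hu₀ hT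
  have hE₂ := h₂.timeEnergy_lt_top hH hA hp hΩm hΩ hu₀ hT
  have hwW : MemLpWsp s p T w := (h₁.memLpWsp T hT).midpoint hp.le (h₂.memLpWsp T hT)
  have hw0 : MemLpWspZero Ω s p T fun t x => w t x - u₀ x := by
    have e : (fun t x => w t x - u₀ x)
        = fun t x => ((u₁ t x - u₀ x) + (u₂ t x - u₀ x)) / 2 := by
      funext t x
      simp only [hw]
      ring
    have hW : MemLpWsp s p T fun t x => w t x - u₀ x := by
      rw [e]
      exact (h₁.sub_mem T hT).memLpWsp.midpoint hp.le (h₂.sub_mem T hT).memLpWsp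
    refine ⟨hW, ?_⟩
    filter_upwards [hW.memWsp, (h₁.sub_mem T hT).memWspZero, (h₂.sub_mem T hT).memWspZero]
      with t a0 a1 a2
    refine ⟨a0, ?_⟩
    filter_upwards [a1.2, a2.2] with x b1 b2 hx
    simp only [hw]
    linarith [b1 hx, b2 hx]
  have hL₁ := h₁.memLp_prod hT
  have hL₂ := h₂.memLp_prod hT
  have hLw : MemLp (fun z : ℝ × Space N => w z.1 z.2) 2 (volume.restrict (Ioo 0 T ×ˢ Ω)) := by
    refine ((hL₁.add hL₂).const_mul (1 / 2)).ae_eq (Eventually.of_forall fun z => ?_)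
    simp only [hw, Pi.add_apply]
    ring
  obtain ⟨v, hv, hv0, hvE⟩ := exists_comparison hH hA hp hΩm hΩ hT hu₀ hwW hw0 hLw hh
  have hmid := two_mul_timeEnergy_midpoint_le hH hA (h₁.memLpWsp T hT) (h₂.memLpWsp T hT)
  have hwE : timeEnergy H T w < ⊤ := ENNReal.lt_top_of_mul_ne_top_right
    (hmid.trans_lt (ENNReal.add_lt_top.2 ⟨hE₁, hE₂⟩)).ne two_ne_zero
  have hhE : ENNReal.ofReal h * energy H u₀ < ⊤ :=
    ENNReal.mul_lt_top ENNReal.ofReal_lt_top hu₀.energy_lt_top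
  have hvt : timeEnergy H T v < ⊤ := hvE.trans_lt (ENNReal.add_lt_top.2 ⟨hhE, hwE⟩)
  have r1 : (timeEnergy H T v).toReal
      ≤ h * (energy H u₀).toReal + (timeEnergy H T w).toReal := by
    have := ENNReal.toReal_mono (ENNReal.add_lt_top.2 ⟨hhE, hwE⟩).ne hvE
    rwa [ENNReal.toReal_add hhE.ne hwE.ne, ENNReal.toReal_mul, ENNReal.toReal_ofReal hh.le] at this
  have r2 : 2 * (timeEnergy H T w).toReal
      ≤ (timeEnergy H T u₁).toReal + (timeEnergy H T u₂).toReal := by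
    have := ENNReal.toReal_mono (ENNReal.add_lt_top.2 ⟨hE₁, hE₂⟩).ne hmid
    rwa [ENNReal.toReal_add hE₁.ne hE₂.ne, ENNReal.toReal_mul, ENNReal.toReal_ofNat] at this
  have i1 := h₁.toReal_inequality hT hE₁ hv hvt hv0
  have i2 := h₂.toReal_inequality hT hE₂ hv hvt hv0
  have hvm : AEStronglyMeasurable (fun z : ℝ × Space N => v z.1 z.2)
      (volume.restrict (Ioo 0 T ×ˢ Ω)) :=
    hv.memLpWsp.aestronglyMeasurable.mono_measure
      (Measure.restrict_mono (prod_mono_right (subset_univ Ω)) le_rfl)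
  have hLv := hv.memCL2.memLp_prod hvm
  have j1 := hv.timeDeriv.memLp.integrable_mul (hLv.sub hL₁)
  have j2 := hv.timeDeriv.memLp.integrable_mul (hLv.sub hL₂)
  -- Here the choice of `w` matters: `u₁ + u₂ = 2w` makes the sum of the integrands minus a square.
  have hneg : (∫ z in Ioo 0 T ×ˢ Ω, h⁻¹ * (w z.1 z.2 - v z.1 z.2) * (v z.1 z.2 - u₁ z.1 z.2)) +
      ∫ z in Ioo 0 T ×ˢ Ω, h⁻¹ * (w z.1 z.2 - v z.1 z.2) * (v z.1 z.2 - u₂ z.1 z.2) ≤ 0 := by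
    refine (integral_add j1 j2).symm.trans_le ?_
    refine integral_nonpos fun z => ?_
    have e : h⁻¹ * (w z.1 z.2 - v z.1 z.2) * (v z.1 z.2 - u₁ z.1 z.2)
        + h⁻¹ * (w z.1 z.2 - v z.1 z.2) * (v z.1 z.2 - u₂ z.1 z.2)
        = -(2 * h⁻¹ * (w z.1 z.2 - v z.1 z.2) ^ 2) := by
      simp only [hw]
      ring
    have : 0 ≤ 2 * h⁻¹ * (w z.1 z.2 - v z.1 z.2) ^ 2 := by positivity
    simp only [Pi.zero_apply]
    exact e.le.trans (neg_nonpos.2 this)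
  have hTm : T ∈ Icc 0 T := ⟨hT.le, le_rfl⟩
  have k1 := ((hv.memCL2.memLp T hTm).sub ((h₁.memCL2 T hT).memLp T hTm)).integrable_sq
  have k2 := ((hv.memCL2.memLp T hTm).sub ((h₂.memCL2 T hT).memLp T hTm)).integrable_sq
  have k0 := (((h₁.memCL2 T hT).memLp T hTm).sub ((h₂.memCL2 T hT).memLp T hTm)).integrable_sq
  have hpar : ∫ x in Ω, (u₁ T x - u₂ T x) ^ 2
      ≤ 2 * ((∫ x in Ω, (v T x - u₁ T x) ^ 2) + ∫ x in Ω, (v T x - u₂ T x) ^ 2) := by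
    have k3 : ∫ x in Ω, 2 * ((v T x - u₁ T x) ^ 2 + (v T x - u₂ T x) ^ 2)
        = 2 * ((∫ x in Ω, (v T x - u₁ T x) ^ 2) + ∫ x in Ω, (v T x - u₂ T x) ^ 2) := by
      rw [integral_const_mul]
      congr 1
      exact integral_add k1 k2
    rw [← k3]
    refine integral_mono k0 ((k1.add k2).const_mul 2) fun x => ?_
    change (u₁ T x - u₂ T x) ^ 2 ≤ 2 * ((v T x - u₁ T x) ^ 2 + (v T x - u₂ T x) ^ 2)
    nlinarith [sq_nonneg ((v T x - u₁ T x) + (v T x - u₂ T x))]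
  -- With `S` the sum of the two squared distances from `v(T)`, the energies cancel to leave `S / 2
  -- ≤ 2 h E(u₀)`; the bound `2 S` for the left side gives the constant `8`.
  linarith

lemma ae_eq_of_pos (hH : StructureCondition A s p H) (hA : 0 < A) (hp : 1 < p)
    (hΩm : MeasurableSet Ω) (hΩ : volume Ω < ⊤) (hu₀ : DataCondition Ω s p H u₀)
    (h₁ : IsVariationalSolution Ω s p H u₀ u₁) (h₂ : IsVariationalSolution Ω s p H u₀ u₂)
    {T : ℝ} (hT : 0 < T) : u₁ T =ᵐ[volume.restrict Ω] u₂ T := by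
  have hle : ∫ x in Ω, (u₁ T x - u₂ T x) ^ 2 ≤ 0 := by
    have hlim : Tendsto (fun h : ℝ => 8 * (h * (energy H u₀).toReal)) (𝓝[>] 0) (𝓝 0) := by
      have hc : Continuous fun h : ℝ => 8 * (h * (energy H u₀).toReal) := by fun_prop
      have := hc.tendsto 0
      simp only [zero_mul, mul_zero] at this
      exact this.mono_left nhdsWithin_le_nhds
    refine ge_of_tendsto hlim ?_
    filter_upwards [self_mem_nhdsWithin] with h hh
      using integral_sub_sq_le hH hA hp hΩm hΩ hu₀ h₁ h₂ hT hh
  have hTm : T ∈ Icc 0 T := ⟨hT.le, le_rfl⟩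
  have k0 := (((h₁.memCL2 T hT).memLp T hTm).sub ((h₂.memCL2 T hT).memLp T hTm)).integrable_sq
  have h0 := (integral_eq_zero_iff_of_nonneg (fun x => sq_nonneg _) k0).1
    (le_antisymm hle (integral_nonneg fun x => sq_nonneg _))
  filter_upwards [h0] with x hx
  have : u₁ T x - u₂ T x = 0 := by simpa using hx
  linarith

/-- Both functions are continuous into `L²(Ω)` at time `0`, so equality at positive times passes to
the limit. -/
lemma MemCL2.ae_eq_zero {T : ℝ} (hT : 0 < T) (h₁ : MemCL2 Ω T u₁) (h₂ : MemCL2 Ω T u₂)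
    (h : ∀ t, 0 < t → u₁ t =ᵐ[volume.restrict Ω] u₂ t) :
    u₁ 0 =ᵐ[volume.restrict Ω] u₂ 0 := by
  have h0 : (0 : ℝ) ∈ Icc 0 T := ⟨le_rfl, hT.le⟩
  have hle : 𝓝[Ioc 0 T] (0 : ℝ) ≤ 𝓝[Icc 0 T] 0 := nhdsWithin_mono _ Ioc_subset_Icc_self
  have hlim := ((h₁.tendsto 0 h0).mono_left hle).add ((h₂.tendsto 0 h0).mono_left hle)
  rw [add_zero] at hlim
  have : (𝓝[Ioc 0 T] (0 : ℝ)).NeBot := by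
    rw [nhdsWithin_Ioc_eq_nhdsGT hT]
    infer_instance
  have hz : eLpNorm (u₁ 0 - u₂ 0) 2 (volume.restrict Ω) ≤ 0 := by
    refine ge_of_tendsto hlim ?_
    filter_upwards [self_mem_nhdsWithin] with t ht
    have htm := Ioc_subset_Icc_self ht
    have e : u₁ 0 - u₂ 0 =ᵐ[volume.restrict Ω] (u₂ t - u₂ 0) - (u₁ t - u₁ 0) := by
      filter_upwards [h t ht.1] with x hx
      simp only [Pi.sub_apply, hx]
      ring
    rw [eLpNorm_congr_ae e, add_comm]
    exact eLpNorm_sub_le ((h₂.memLp t htm).sub (h₂.memLp 0 h0)).1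
      ((h₁.memLp t htm).sub (h₁.memLp 0 h0)).1 one_le_two
  have hz' := (eLpNorm_eq_zero_iff ((h₁.memLp 0 h0).sub (h₂.memLp 0 h0)).1 two_ne_zero).1
    (le_antisymm hz zero_le)
  filter_upwards [hz'] with x hx
  have : u₁ 0 x - u₂ 0 x = 0 := hx
  linarith

/-- Outside `Ω` both functions equal `u₀`. Passing from almost every time slice to the product
measure requires a measurable set, hence the detour through measurable representatives. -/
lemma ae_eq_prod_of_ae_eq (hΩm : MeasurableSet Ω) {T : ℝ} (h₁ : MemLpWsp s p T u₁)
    (h₂ : MemLpWsp s p T u₂) (h₁' : MemLpWspZero Ω s p T fun t x => u₁ t x - u₀ x)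
    (h₂' : MemLpWspZero Ω s p T fun t x => u₂ t x - u₀ x)
    (h : ∀ t, 0 < t → u₁ t =ᵐ[volume.restrict Ω] u₂ t) :
    ∀ᵐ z ∂((volume : Measure (ℝ × Space N)).restrict (Ioo 0 T ×ˢ univ)),
      u₁ z.1 z.2 = u₂ z.1 z.2 := by
  obtain ⟨w₁, hm₁, e₁⟩ := h₁.exists_measurable
  obtain ⟨w₂, hm₂, e₂⟩ := h₂.exists_measurable
  have e₁' := ae_ae_of_ae_restrict_prod (P := fun t x => u₁ t x = w₁ t x) e₁
  have e₂' := ae_ae_of_ae_restrict_prod (P := fun t x => u₂ t x = w₂ t x) e₂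
  have hw : ∀ᵐ z ∂((volume : Measure (ℝ × Space N)).restrict (Ioo 0 T ×ˢ univ)),
      w₁ z.1 z.2 = w₂ z.1 z.2 := by
    rw [restrict_Ioo_prod, Measure.ae_prod_iff_ae_ae
      (p := fun z : ℝ × Space N => w₁ z.1 z.2 = w₂ z.1 z.2) (measurableSet_eq_fun hm₁ hm₂)]
    filter_upwards [e₁', e₂', h₁'.memWspZero, h₂'.memWspZero, ae_restrict_mem measurableSet_Ioo]
      with t a1 a2 a3 a4 ht
    rw [Measure.restrict_univ] at a1 a2 ⊢
    filter_upwards [a1, a2, a3.2, a4.2, (ae_restrict_iff' hΩm).1 (h t ht.1)]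
      with x b1 b2 b3 b4 b5
    rw [← b1, ← b2]
    by_cases hx : x ∈ Ω
    · exact b5 hx
    · linarith [b3 hx, b4 hx]
  filter_upwards [e₁, e₂, hw] with z a1 a2 a3
  rw [a1, a2, a3]

end NonlocalEvolution

open NonlocalEvolution
theorem theorem2 (N : ℕ) (hN : 0 < N)
    (Ω : Set (Space N)) (hΩ : IsOpen Ω) (hΩb : Bornology.IsBounded Ω)
    (s p A : ℝ) (hs0 : 0 < s) (hs1 : s < 1) (hp : 1 < p) (hA : 0 < A)
    (H : Space N → Space N → ℝ → ℝ) (hH : StructureCondition A s p H)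
    (hstrict : ∀ᵐ z : Space N × Space N, StrictConvexOn ℝ univ (H z.1 z.2))
    (u₀ : Space N → ℝ) (hu₀ : DataCondition Ω s p H u₀)
    (u₁ u₂ : ℝ → Space N → ℝ)
    (h₁ : IsVariationalSolution Ω s p H u₀ u₁)
    (h₂ : IsVariationalSolution Ω s p H u₀ u₂) :
    (∀ᵐ z ∂(volume.restrict (Ioi (0 : ℝ) ×ˢ (univ : Set (Space N)))),
      u₁ z.1 z.2 = u₂ z.1 z.2) ∧
    ∀ t : ℝ, 0 ≤ t → u₁ t =ᵐ[volume.restrict Ω] u₂ t := by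
  have hpos : ∀ t, 0 < t → u₁ t =ᵐ[volume.restrict Ω] u₂ t := fun t ht =>
    ae_eq_of_pos hH hA hp hΩ.measurableSet hΩb.measure_lt_top hu₀ h₁ h₂ ht
  refine ⟨?_, fun t ht => ?_⟩
  -- Exhaustion by countably many finite time intervals; `n + 1` keeps the length positive at `n =
  -- 0`.
  · have hU : Ioi (0 : ℝ) ×ˢ (univ : Set (Space N))
        = ⋃ n : ℕ, Ioo (0 : ℝ) (n + 1) ×ˢ (univ : Set (Space N)) := by
      ext z
      simp only [mem_prod, mem_Ioi, mem_univ, and_true, mem_iUnion, mem_Ioo]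
      refine ⟨fun hz => ?_, fun ⟨n, hn⟩ => hn.1⟩
      obtain ⟨n, hn⟩ := exists_nat_gt z.1
      exact ⟨n, hz, by linarith⟩
    rw [hU, ae_restrict_iUnion_iff]
    intro n
    have hn : (0 : ℝ) < n + 1 := by positivity
    exact ae_eq_prod_of_ae_eq hΩ.measurableSet (h₁.memLpWsp _ hn) (h₂.memLpWsp _ hn)
      (h₁.sub_mem _ hn) (h₂.sub_mem _ hn) hpos
  · rcases ht.eq_or_lt with rfl | ht
    · exact (h₁.memCL2 1 one_pos).ae_eq_zero one_pos (h₂.memCL2 1 one_pos) hpos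
    · exact hpos t ht
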